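/- **Setup.** Let $\Gamma=\{e_1,e_{11},e_2,e_{22},e_{12}\}$. Let $L$ be the Lie algebra over $\mathbb{Q}$ generated by $\Gamma$ with the relations $[e_1,e_2]=[e_{11},e_2]=[e_1,e_{22}]=0$ and $[e_{11},e_{22}]=-[e_{11},e_{12}]=[e_{22},e_{12}]=[e_2-e_1,e_{12}]$. Let $N\subset L$ be the Lie ideal generated by $e_{11},e_{22},e_{12}$, and let $L^{PL}=L/[N,N]$. Let $\pi^{PL}$ be the prounipotent $\mathbb{Q}$-group of the pronilpotent completion of $L^{PL}$. Its coordinate ring $A^{PL}$ is a Hopf subalgebra of the shuffle algebra $A(\Gamma)$ (with deconcatenation coproduct), namely the functions on words that factor through the universal enveloping algebra of $L^{PL}$. It is graded by half-weight, each letter of $\Gamma$ having half-weight $1$. For a word $w$ write $f_w$ for the corresponding basis element of the shuffle algebra, and put $f_{\sum a_iw_i}=\sum a_if_{w_i}$. Let $$\Lambda=\{e_1,\ e_2\}\cup\{e_{11}e_1^{k},\ e_{22}e_2^{k},\ e_{12}(e_1+e_2)^{k} : k\ge 0\},$$ where the last three have half-weight $k+1$ and $e_1,e_2$ have half-weight $1$.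 For $\lambda\in\Lambda$ one has $f_\lambda\in A^{PL}$. Let $\Sigma$ be a set of generators consisting of an arbitrary finite set $\Sigma_{-1}$ of generators of half-weight $1$ and one generator $\sigma_m$ of half-weight $m$ for every odd $m$ with $3\le m\le M$, where $M\geq 0$ is a fixed integer; put $\Sigma_{-m}=\{\sigma_m\}$ for these $m$, and $\Sigma_{-m}=\emptyset$ for all other $m\neq 1$. Let $\pi(\Sigma)$ be the free graded prounipotent group over $\mathbb{Q}$ on $\Sigma$; its coordinate ring is the shuffle algebra on words in $\Sigma$, graded by half-weight. Let $R$ be a commutative $\mathbb{Q}$-algebra. A $\mathbb{G}_m$-equivariant $R$-cocycle is a $\mathbb{G}_m$-equivariant cocycle $c:\pi(\Sigma)_R\to\pi^{PL}_R$ for the trivial action of $\pi(\Sigma)$ on $\pi^{PL}$, that is, a homomorphism of group schemes over $R$ whose comorphism $c^\sharp$ preserves the gradings. For $\lambda$ in the linear span of $\Lambda$ and a word $w$ in $\Sigma$, let $\phi^w_\lambda(c)\in R$ be the coefficient of $f_w$ in $c^\sharp f_\lambda$. **Proposition.** (a) Let $c$ be a $\mathbb{G}_m$-equivariant $R$-cocycle.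 For all $0\le r\le n$, $\tau_1,\dots,\tau_r\in\Sigma_{-1}$ and $\sigma\in\Sigma_{r-n}$, $$\phi^{\sigma\tau_1\cdots\tau_r}_{e_{11}e_1^{n-1}}(c)=\phi^{\sigma}_{e_{11}e_1^{n-r-1}}(c)\,\phi^{\tau_1}_{e_1}(c)\cdots\phi^{\tau_r}_{e_1}(c),$$ $$\phi^{\sigma\tau_1\cdots\tau_r}_{e_{22}e_2^{n-1}}(c)=\phi^{\sigma}_{e_{22}e_2^{n-r-1}}(c)\,\phi^{\tau_1}_{e_2}(c)\cdots\phi^{\tau_r}_{e_2}(c),$$ $$\phi^{\sigma\tau_1\cdots\tau_r}_{e_{12}(e_1+e_2)^{n-1}}(c)=\phi^{\sigma}_{e_{12}(e_1+e_2)^{n-r-1}}(c)\,\phi^{\tau_1}_{e_1+e_2}(c)\cdots\phi^{\tau_r}_{e_1+e_2}(c).$$ Moreover, for every $\lambda\in\Lambda$ and every word $w$ in $\Sigma$, one has $\phi^w_\lambda(c)=0$ unless $w$ has the same half-weight as $\lambda$ and is of the form $\sigma\tau_1\cdots\tau_r$ with $r\ge0$, $\sigma\in\Sigma$ and $\tau_1,\dots,\tau_r\in\Sigma_{-1}$.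 (b) Conversely, given arbitrary elements $a^\rho_\lambda\in R$ for all $\rho\in\Sigma$ and $\lambda\in\Lambda$ of equal half-weight, there exists one and only one $\mathbb{G}_m$-equivariant $R$-cocycle $c$ such that $\phi^\rho_\lambda(c)=a^\rho_\lambda$ for all such $\rho,\lambda$. -/

import Mathlib

open scoped TensorProduct

noncomputable section

/-- All shuffles (with multiplicity) of two words: the interleavings of `u` and `v`. -/
def shuffles {X : Type*} : List X → List X → List (List X)
  | [], v => [v]
  | a :: u, [] => [a :: u]
  | a :: u, b :: v =>
      (shuffles u (b :: v)).map (List.cons a) ++ (shuffles (a :: u) v).map (List.cons b)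
termination_by u v => u.length + v.length

/-- The vector space underlying the shuffle algebra on the alphabet `X`: it has a basis
`f_w` indexed by the words `w` in `X`. -/
def Sh (X : Type*) : Type _ := List X →₀ ℚ

namespace Sh

variable {X : Type*}

instance : AddCommGroup (Sh X) := inferInstanceAs (AddCommGroup (List X →₀ ℚ))
instance : Module ℚ (Sh X) := inferInstanceAs (Module ℚ (List X →₀ ℚ))

/-- The basis vector `f_w` attached to a word `w`. -/
def word (w : List X) : Sh X := Finsupp.single w (1 : ℚ)

/-- The coefficient of `f_w`, that is, the pairing `⟨-, w⟩` with the word `w`. -/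
def coeff (w : List X) : Sh X →ₗ[ℚ] ℚ := Finsupp.lapply (M := ℚ) (R := ℚ) w

/-- The identification with the finitely supported functions on words. -/
def toFinsupp : Sh X ≃ₗ[ℚ] (List X →₀ ℚ) where
  toFun f := f
  invFun f := f
  map_add' _ _ := rfl
  map_smul' _ _ := rfl

/-- The basis of words. -/
def basis : Module.Basis (List X) ℚ (Sh X) := .ofRepr toFinsupp

lemma basis_apply (w : List X) : basis w = word w := by
  rw [basis, Module.Basis.coe_ofRepr]; rfl

lemma coeff_eq_repr (w : List X) (f : Sh X) : coeff w f = basis.repr f w := rfl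

lemma coeff_word (u v : List X) [Decidable (u = v)] : coeff v (word u) = if u = v then 1 else 0 :=
  Finsupp.single_apply

lemma ext_coeff {f g : Sh X} (h : ∀ w, coeff w f = coeff w g) : f = g := Finsupp.ext h

lemma hom_ext {M : Type*} [AddCommGroup M] [Module ℚ M] {F G : Sh X →ₗ[ℚ] M}
    (h : ∀ w, F (word w) = G (word w)) : F = G :=
  basis.ext fun w => by rw [basis_apply, h]

/-- The bilinear shuffle product, `f_u ⧢ f_v = ∑ f_w` over all shuffles `w` of `u` and `v`. -/
def mulBilin : Sh X →ₗ[ℚ] Sh X →ₗ[ℚ] Sh X :=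
  basis.constr ℚ fun u => basis.constr ℚ fun v => ((shuffles u v).map word).sum

lemma mulBilin_word (u v : List X) :
    mulBilin (word u) (word v) = ((shuffles u v).map word).sum := by
  rw [mulBilin, ← basis_apply u, Module.Basis.constr_basis, ← basis_apply v,
    Module.Basis.constr_basis]

instance : Mul (Sh X) := ⟨fun f g => mulBilin f g⟩
instance : One (Sh X) := ⟨word []⟩

lemma mul_def (f g : Sh X) : f * g = mulBilin f g := rfl
lemma one_def : (1 : Sh X) = word [] := rfl

/-- Prepending a letter: `f_w ↦ f_{aw}`. -/
def cons (a : X) : Sh X →ₗ[ℚ] Sh X := basis.constr ℚ fun w => word (a :: w)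

lemma cons_word (a : X) (w : List X) : cons a (word w) = word (a :: w) := by
  rw [cons, ← basis_apply, Module.Basis.constr_basis]

open Classical in
/-- Deleting an initial letter: `f_{aw} ↦ f_w`, and the other words go to `0`. -/
def del (a : X) : Sh X →ₗ[ℚ] Sh X :=
  basis.constr ℚ fun w => match w with
    | [] => 0
    | b :: w => if b = a then word w else 0

lemma del_nil (a : X) : del a (word []) = 0 := by
  rw [del, ← basis_apply, Module.Basis.constr_basis]

open Classical in
lemma del_cons (a b : X) (w : List X) :
    del a (word (b :: w)) = if b = a then word w else 0 := by
  rw [del, ← basis_apply, Module.Basis.constr_basis]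

lemma coeff_del (a : X) (w : List X) (f : Sh X) : coeff w (del a f) = coeff (a :: w) f := by
  classical
  suffices h : (coeff w).comp (del a) = coeff (a :: w) from congrArg (· f) h
  refine hom_ext fun u => ?_
  cases u with
  | nil => simp [del_nil, coeff_word]
  | cons b u =>
    rw [LinearMap.comp_apply, del_cons, coeff_word]
    split_ifs with h1 h2 h2
    · rw [coeff_word]; simp_all
    · rw [coeff_word]; simp_all
    · simp_all
    · simp

lemma coeff_nil_mul (f g : Sh X) : coeff [] (f * g) = coeff [] f * coeff [] g := by
  classical
  suffices h : mulBilin.compr₂ (coeff []) =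
      (LinearMap.mul ℚ ℚ).compl₁₂ (coeff (X := X) []) (coeff []) from
    congrArg (fun F => F f g) h
  refine hom_ext fun u => hom_ext fun v => ?_
  simp only [LinearMap.compr₂_apply, LinearMap.compl₁₂_apply, LinearMap.mul_apply', mulBilin_word]
  rcases u with _ | ⟨a, u⟩ <;> rcases v with _ | ⟨b, v⟩ <;>
    simp [shuffles, coeff_word, Function.comp_def, map_list_sum]

lemma del_mul (a : X) (f g : Sh X) : del a (f * g) = del a f * g + f * del a g := by
  classical
  suffices h : mulBilin.compr₂ (del a) =
      mulBilin.compl₁₂ (del a) LinearMap.id + mulBilin.compl₁₂ LinearMap.id (del a) from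
    congrArg (fun F => F f g) h
  refine hom_ext fun u => hom_ext fun v => ?_
  simp only [LinearMap.compr₂_apply, LinearMap.compl₁₂_apply, LinearMap.add_apply,
    LinearMap.id_apply, mulBilin_word]
  rcases u with _ | ⟨b, u⟩
  · rcases v with _ | ⟨c, v⟩
    · simp [shuffles, del_nil]
    · by_cases h : c = a <;> simp [shuffles, del_nil, del_cons, h, mulBilin_word]
  · rcases v with _ | ⟨c, v⟩
    · by_cases h : b = a
      · simp only [shuffles, del_nil, del_cons, h]
        cases u <;> simp [shuffles, mulBilin_word, del_cons]
      · simp [shuffles, del_nil, del_cons, h]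
    · by_cases h : b = a <;> by_cases h' : c = a <;>
        simp [shuffles, del_cons, h, h', mulBilin_word, map_list_sum, Function.comp_def]

lemma coeff_cons_mul (a : X) (w : List X) (f g : Sh X) :
    coeff (a :: w) (f * g) = coeff w (del a f * g) + coeff w (f * del a g) := by
  rw [← coeff_del, del_mul, map_add]

lemma mul_add' (f g h : Sh X) : f * (g + h) = f * g + f * h := map_add (mulBilin f) g h
lemma add_mul' (f g h : Sh X) : (f + g) * h = f * h + g * h := by
  simp [mul_def]

lemma mul_comm' (f g : Sh X) : f * g = g * f := by
  refine ext_coeff fun w => ?_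
  induction w generalizing f g with
  | nil => rw [coeff_nil_mul, coeff_nil_mul, mul_comm]
  | cons a w ih => rw [coeff_cons_mul, coeff_cons_mul, ih, ih f, add_comm]

lemma mul_assoc' (f g h : Sh X) : f * g * h = f * (g * h) := by
  refine ext_coeff fun w => ?_
  induction w generalizing f g h with
  | nil => simp only [coeff_nil_mul, mul_assoc]
  | cons a w ih =>
    simp only [coeff_cons_mul, del_mul, mul_add', add_mul', map_add, ih]
    ring

lemma one_mul' (f : Sh X) : 1 * f = f := by
  classical
  refine ext_coeff fun w => ?_
  induction w generalizing f with
  | nil => simp [coeff_nil_mul, one_def, coeff_word]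
  | cons a w ih =>
    rw [coeff_cons_mul, ih, coeff_del, one_def, del_nil]
    simp [mul_def]

/-- The shuffle algebra: a commutative ring. -/
instance : CommRing (Sh X) where
  mul_assoc := mul_assoc'
  one_mul := one_mul'
  mul_one f := by rw [mul_comm', one_mul']
  left_distrib := mul_add'
  right_distrib := add_mul'
  zero_mul f := by simp [mul_def]
  mul_zero f := by simp [mul_def]
  mul_comm := mul_comm'
  zsmul := fun n f => n • f
  zsmul_zero' := zero_zsmul
  zsmul_succ' n f := SubNegMonoid.zsmul_succ' n f
  zsmul_neg' n f := SubNegMonoid.zsmul_neg' n f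
  nsmul := fun n f => n • f
  nsmul_zero := zero_nsmul
  nsmul_succ n f := succ_nsmul f n
  neg_add_cancel := neg_add_cancel
  sub_eq_add_neg := sub_eq_add_neg

instance : Algebra ℚ (Sh X) :=
  Algebra.ofModule (fun r f g => by simp [mul_def]) (fun r f g => by simp [mul_def])

lemma coeff_one (w : List X) [Decidable ([] = w)] : coeff w (1 : Sh X) = if [] = w then 1 else 0 :=
  coeff_word _ _

lemma coeff_nil_one : coeff [] (1 : Sh X) = 1 := by
  classical exact (coeff_one []).trans (if_pos rfl)

/-- The counit: the coefficient of the empty word. -/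
def counitHom : Sh X →ₐ[ℚ] ℚ :=
  AlgHom.ofLinearMap (coeff []) coeff_nil_one coeff_nil_mul

lemma counitHom_apply (f : Sh X) : counitHom f = coeff [] f := rfl

/-- The deconcatenation coproduct `f_w ↦ ∑_{w = uv} f_u ⊗ f_v`. -/
def comulLin : Sh X →ₗ[ℚ] Sh X ⊗[ℚ] Sh X :=
  basis.constr ℚ fun w =>
    ∑ i ∈ Finset.range (w.length + 1), word (w.take i) ⊗ₜ[ℚ] word (w.drop i)

lemma comulLin_word (w : List X) : comulLin (word w) =
    ∑ i ∈ Finset.range (w.length + 1), word (w.take i) ⊗ₜ[ℚ] word (w.drop i) := by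
  rw [comulLin, ← basis_apply, Module.Basis.constr_basis]

/-- The coefficient of `f_u ⊗ f_v`. -/
def coeff₂ (u v : List X) : Sh X ⊗[ℚ] Sh X →ₗ[ℚ] ℚ :=
  LinearMap.mul' ℚ ℚ ∘ₗ TensorProduct.map (coeff u) (coeff v)

lemma coeff₂_tmul (u v : List X) (f g : Sh X) :
    coeff₂ u v (f ⊗ₜ g) = coeff u f * coeff v g := rfl

lemma ext_coeff₂ {s t : Sh X ⊗[ℚ] Sh X} (h : ∀ u v, coeff₂ u v s = coeff₂ u v t) : s = t := by
  apply (basis.tensorProduct basis).repr.injective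
  ext ⟨u, v⟩
  have key : ∀ s : Sh X ⊗[ℚ] Sh X, (basis.tensorProduct basis).repr s (u, v) = coeff₂ u v s := by
    intro s
    induction s with
    | zero => simp
    | add x y hx hy => simp [hx, hy]
    | tmul x y =>
      simp [coeff₂_tmul, Module.Basis.tensorProduct_repr_tmul_apply, coeff_eq_repr, mul_comm]
  rw [key, key, h]

lemma coeff₂_comulLin (u v : List X) (f : Sh X) :
    coeff₂ u v (comulLin f) = coeff (u ++ v) f := by
  classical
  suffices h : (coeff₂ u v).comp comulLin = coeff (u ++ v) from congrArg (· f) h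
  refine hom_ext fun w => ?_
  rw [LinearMap.comp_apply, comulLin_word, map_sum]
  simp only [coeff₂_tmul, coeff_word]
  split_ifs with h
  · subst h
    rw [Finset.sum_eq_single u.length]
    · simp
    · intro i hi hne
      simp only [Finset.mem_range, List.length_append] at hi
      rw [if_neg, zero_mul]
      intro h
      have := congrArg List.length h
      simp only [List.length_take, List.length_append] at this
      omega
    · intro h
      simp at h
  · refine Finset.sum_eq_zero fun i hi => ?_
    by_cases h1 : w.take i = u
    · rw [if_neg (c := w.drop i = v), mul_zero]
      rintro h2
      exact h (by rw [← h1, ← h2, List.take_append_drop])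
    · rw [if_neg h1, zero_mul]

lemma del_one (a : X) : del a 1 = 0 := del_nil a

/-- Deletion of a letter in the left tensor factor. -/
def delL (a : X) : Sh X ⊗[ℚ] Sh X →ₗ[ℚ] Sh X ⊗[ℚ] Sh X := (del a).rTensor (Sh X)

lemma coeff₂_delL (a : X) (u v : List X) (t : Sh X ⊗[ℚ] Sh X) :
    coeff₂ u v (delL a t) = coeff₂ (a :: u) v t := by
  induction t with
  | zero => simp
  | add x y hx hy => simp [hx, hy]
  | tmul x y => simp [delL, coeff₂_tmul, coeff_del]

lemma delL_mul (a : X) (s t : Sh X ⊗[ℚ] Sh X) :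
    delL a (s * t) = delL a s * t + s * delL a t := by
  induction s with
  | zero => simp
  | add x y hx hy => simp only [add_mul, map_add, hx, hy]; abel
  | tmul x y =>
    induction t with
    | zero => simp
    | add z w hz hw => simp only [mul_add, map_add, hz, hw]; abel
    | tmul z w => simp [delL, del_mul, TensorProduct.add_tmul]

lemma delL_comulLin (a : X) (f : Sh X) : delL a (comulLin f) = comulLin (del a f) :=
  ext_coeff₂ fun u v => by simp [coeff₂_delL, coeff₂_comulLin, coeff_del]

lemma coeff₂_nil_mul (v : List X) (s t : Sh X ⊗[ℚ] Sh X) :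
    coeff₂ [] v (s * t) =
      coeff v (Algebra.TensorProduct.lid ℚ (Sh X) (Algebra.TensorProduct.map counitHom
        (.id ℚ _) s) * Algebra.TensorProduct.lid ℚ (Sh X) (Algebra.TensorProduct.map counitHom
        (.id ℚ _) t)) := by
  rw [← map_mul, ← map_mul]
  generalize s * t = r
  induction r with
  | zero => simp
  | add x y hx hy => simp only [map_add, hx, hy]
  | tmul x y => simp [coeff₂_tmul, counitHom_apply]

lemma lid_counit_comulLin (f : Sh X) : Algebra.TensorProduct.lid ℚ (Sh X)
    (Algebra.TensorProduct.map counitHom (.id ℚ _) (comulLin f)) = f := by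
  refine ext_coeff fun v => ?_
  have key : ∀ s : Sh X ⊗[ℚ] Sh X, coeff v (Algebra.TensorProduct.lid ℚ (Sh X)
    (Algebra.TensorProduct.map counitHom (.id ℚ _) s)) = coeff₂ [] v s := by
    intro s
    induction s with
    | zero => simp
    | add x y hx hy => simp only [map_add, hx, hy]
    | tmul x y => simp [coeff₂_tmul, counitHom_apply]
  rw [key, coeff₂_comulLin, List.nil_append]

lemma rid_counit_comulLin (f : Sh X) : Algebra.TensorProduct.rid ℚ ℚ (Sh X)
    (Algebra.TensorProduct.map (.id ℚ _) counitHom (comulLin f)) = f := by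
  refine ext_coeff fun v => ?_
  have key : ∀ s : Sh X ⊗[ℚ] Sh X, coeff v (Algebra.TensorProduct.rid ℚ ℚ (Sh X)
    (Algebra.TensorProduct.map (.id ℚ _) counitHom s)) = coeff₂ v [] s := by
    intro s
    induction s with
    | zero => simp
    | add x y hx hy => simp only [map_add, hx, hy]
    | tmul x y => simp [coeff₂_tmul, counitHom_apply, mul_comm]
  rw [key, coeff₂_comulLin, List.append_nil]

lemma comulLin_mul (f g : Sh X) : comulLin (f * g) = comulLin f * comulLin g := by
  refine ext_coeff₂ fun u v => ?_
  induction u generalizing f g with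
  | nil =>
    rw [coeff₂_nil_mul, lid_counit_comulLin, lid_counit_comulLin, coeff₂_comulLin, List.nil_append]
  | cons a u ih =>
    rw [← coeff₂_delL, ← coeff₂_delL, delL_mul, delL_comulLin, delL_comulLin, delL_comulLin,
      del_mul, map_add, map_add, map_add, ih, ih]

lemma comulLin_one : comulLin (1 : Sh X) = 1 := by
  classical
  rw [one_def, comulLin_word]
  simp [Algebra.TensorProduct.one_def, one_def]

/-- The deconcatenation coproduct as a homomorphism of algebras. -/
def comulHom : Sh X →ₐ[ℚ] Sh X ⊗[ℚ] Sh X :=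
  AlgHom.ofLinearMap comulLin comulLin_one comulLin_mul

lemma comulHom_apply (f : Sh X) : comulHom f = comulLin f := rfl

/-- Contraction with a word in the left tensor factor. -/
def contrL {M : Type*} [AddCommGroup M] [Module ℚ M] (u : List X) : Sh X ⊗[ℚ] M →ₗ[ℚ] M :=
  (TensorProduct.lid ℚ M).toLinearMap ∘ₗ (coeff u).rTensor M

lemma contrL_tmul {M : Type*} [AddCommGroup M] [Module ℚ M] (u : List X) (f : Sh X) (m : M) :
    contrL u (f ⊗ₜ[ℚ] m) = coeff u f • m := by simp [contrL]

lemma ext_contrL {M : Type*} [AddCommGroup M] [Module ℚ M] {s t : Sh X ⊗[ℚ] M}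
    (h : ∀ u, contrL u s = contrL u t) : s = t := by
  classical
  apply (TensorProduct.equivFinsuppOfBasisLeft (N := M) (basis (X := X))).injective
  ext u
  have key : ∀ s : Sh X ⊗[ℚ] M,
      TensorProduct.equivFinsuppOfBasisLeft (N := M) (basis (X := X)) s u = contrL u s := by
    intro s
    induction s with
    | zero => simp
    | add x y hx hy => simp [hx, hy]
    | tmul x y => simp [contrL_tmul, coeff_eq_repr]
  rw [key, key, h]

lemma coeff_contrL (u v : List X) (t : Sh X ⊗[ℚ] Sh X) :
    coeff v (contrL u t) = coeff₂ u v t := by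
  induction t with
  | zero => simp
  | add x y hx hy => simp [hx, hy]
  | tmul x y => simp [contrL_tmul, coeff₂_tmul]

lemma coassoc_aux (f : Sh X) :
    Algebra.TensorProduct.assoc ℚ ℚ ℚ (Sh X) (Sh X) (Sh X)
      (Algebra.TensorProduct.map comulHom (.id ℚ _) (comulLin f)) =
    Algebra.TensorProduct.map (.id ℚ _) comulHom (comulLin f) := by
  refine ext_contrL fun u => ext_coeff₂ fun v w => ?_
  have h1 : ∀ t : Sh X ⊗[ℚ] Sh X, coeff₂ v w (contrL u
      (Algebra.TensorProduct.map (.id ℚ _) comulHom t)) = coeff₂ u (v ++ w) t := by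
    intro t
    induction t with
    | zero => simp
    | add x y hx hy => simp only [map_add, hx, hy]
    | tmul x y => simp [contrL_tmul, coeff₂_tmul, comulHom_apply, coeff₂_comulLin]
  have h0 : ∀ (s : Sh X ⊗[ℚ] Sh X) (y : Sh X), coeff₂ v w (contrL u
      (Algebra.TensorProduct.assoc ℚ ℚ ℚ (Sh X) (Sh X) (Sh X) (s ⊗ₜ y))) =
        coeff₂ u v s * coeff w y := by
    intro s y
    induction s with
    | zero => simp
    | add x z hx hz => simp only [TensorProduct.add_tmul, map_add, hx, hz, add_mul]
    | tmul x z => simp [contrL_tmul, coeff₂_tmul, mul_assoc]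
  have h2 : ∀ t : Sh X ⊗[ℚ] Sh X, coeff₂ v w (contrL u
      (Algebra.TensorProduct.assoc ℚ ℚ ℚ (Sh X) (Sh X) (Sh X)
      (Algebra.TensorProduct.map comulHom (.id ℚ _) t))) = coeff₂ (u ++ v) w t := by
    intro t
    induction t with
    | zero => simp
    | add x y hx hy => simp only [map_add, hx, hy]
    | tmul x y =>
      rw [Algebra.TensorProduct.map_tmul, h0, comulHom_apply, coeff₂_comulLin, coeff₂_tmul]
      rfl
  rw [h1, h2, coeff₂_comulLin, coeff₂_comulLin, List.append_assoc]

/-- The shuffle bialgebra with the deconcatenation coproduct. -/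
instance : Bialgebra ℚ (Sh X) :=
  Bialgebra.ofAlgHom comulHom counitHom
    (AlgHom.ext fun f => coassoc_aux f)
    (AlgHom.ext fun f => (Algebra.TensorProduct.lid ℚ (Sh X)).injective
      (by simpa [comulHom_apply] using lid_counit_comulLin f))
    (AlgHom.ext fun f => (Algebra.TensorProduct.rid ℚ ℚ (Sh X)).injective
      (by simpa [comulHom_apply] using rid_counit_comulLin f))

end Sh

section CoordRing

attribute [local instance] LieRing.ofAssociativeRing

variable {𝔤 : Type*} [LieRing 𝔤] [LieAlgebra ℚ 𝔤]

/-- The coproduct of the universal enveloping algebra: elements of `𝔤` are primitive. -/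
def envComul (𝔤 : Type*) [LieRing 𝔤] [LieAlgebra ℚ 𝔤] : UniversalEnvelopingAlgebra ℚ 𝔤 →ₐ[ℚ]
    UniversalEnvelopingAlgebra ℚ 𝔤 ⊗[ℚ] UniversalEnvelopingAlgebra ℚ 𝔤 :=
  UniversalEnvelopingAlgebra.lift ℚ
    { toFun := fun x => UniversalEnvelopingAlgebra.ι ℚ x ⊗ₜ 1 + 1 ⊗ₜ UniversalEnvelopingAlgebra.ι ℚ x
      map_add' := fun x y => by
        simp only [map_add, TensorProduct.add_tmul, TensorProduct.tmul_add]; abel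
      map_smul' := fun r x => by
        simp only [map_smul, TensorProduct.smul_tmul', TensorProduct.tmul_smul, smul_add,
          RingHom.id_apply]
      map_lie' := fun {x y} => by
        simp only [LieHom.map_lie, LieRing.of_associative_ring_bracket, TensorProduct.sub_tmul,
          TensorProduct.tmul_sub, mul_add, add_mul, Algebra.TensorProduct.tmul_mul_tmul, one_mul,
          mul_one]
        abel }

lemma envComul_ι (x : 𝔤) : envComul 𝔤 (UniversalEnvelopingAlgebra.ι ℚ x) =
    UniversalEnvelopingAlgebra.ι ℚ x ⊗ₜ 1 + 1 ⊗ₜ UniversalEnvelopingAlgebra.ι ℚ x :=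
  UniversalEnvelopingAlgebra.lift_ι_apply ℚ _ _

variable {X : Type*}

/-- The image of the word `w = a₁ ⋯ aₙ` in the universal enveloping algebra of a Lie algebra `𝔤`
with chosen elements `gen a`. -/
def envWord (gen : X → 𝔤) (w : List X) : UniversalEnvelopingAlgebra ℚ 𝔤 :=
  (w.map fun a => UniversalEnvelopingAlgebra.ι ℚ (gen a)).prod

lemma envWord_nil (gen : X → 𝔤) : envWord gen [] = 1 := rfl

lemma envWord_cons (gen : X → 𝔤) (a : X) (w : List X) :
    envWord gen (a :: w) = UniversalEnvelopingAlgebra.ι ℚ (gen a) * envWord gen w := by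
  simp [envWord]

lemma envWord_append (gen : X → 𝔤) (u v : List X) :
    envWord gen (u ++ v) = envWord gen u * envWord gen v := by
  simp [envWord]

lemma coeff_mul_envWord (gen : X → 𝔤) (w : List X) (f g : Sh X)
    (F G : UniversalEnvelopingAlgebra ℚ 𝔤 →ₗ[ℚ] ℚ)
    (hF : ∀ u, Sh.coeff u f = F (envWord gen u)) (hG : ∀ u, Sh.coeff u g = G (envWord gen u)) :
    Sh.coeff w (f * g) =
      LinearMap.mul' ℚ ℚ (TensorProduct.map F G (envComul 𝔤 (envWord gen w))) := by
  induction w generalizing f g F G with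
  | nil =>
    rw [Sh.coeff_nil_mul, hF, hG]
    simp [envWord_nil, Algebra.TensorProduct.one_def]
  | cons a w ih =>
    have h1 := ih (Sh.del a f) g
      (F ∘ₗ LinearMap.mulLeft ℚ (UniversalEnvelopingAlgebra.ι ℚ (gen a))) G
      (fun u => by rw [Sh.coeff_del, hF, envWord_cons]; rfl) hG
    have h2 := ih f (Sh.del a g) F
      (G ∘ₗ LinearMap.mulLeft ℚ (UniversalEnvelopingAlgebra.ι ℚ (gen a))) hF
      (fun u => by rw [Sh.coeff_del, hG, envWord_cons]; rfl)
    rw [Sh.coeff_cons_mul, h1, h2, envWord_cons, map_mul, envComul_ι]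
    generalize envComul 𝔤 (envWord gen w) = t
    induction t with
    | zero => simp
    | add x y hx hy => simp only [map_add, mul_add] at hx hy ⊢; rw [← hx, ← hy]; abel
    | tmul x y => simp [add_mul]

/-- Let `𝔤` be a Lie algebra generated by the elements `gen a`, for `a` in a finite alphabet `X`.
The coordinate ring of the prounipotent group attached to the pronilpotent completion of `𝔤` is
the topological dual of the completed universal enveloping algebra of `𝔤`: the linear functionals
on the universal enveloping algebra that vanish on a power of the augmentation ideal.
Since the words in the generators span, such a functional is determined by its values on words,
and it vanishes on a power of the augmentation ideal if and only if it vanishes on all but finitely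
many words. In this way the coordinate ring becomes
the subalgebra of the shuffle algebra on `X` (the coordinate ring of the free prounipotent group)
of those functions on words that factor through the universal enveloping algebra of `𝔤`. -/
def coordRing (gen : X → 𝔤) : Subalgebra ℚ (Sh X) where
  carrier := {f | ∃ F : UniversalEnvelopingAlgebra ℚ 𝔤 →ₗ[ℚ] ℚ,
    ∀ w, Sh.coeff w f = F (envWord gen w)}
  mul_mem' := by
    rintro f g ⟨F, hF⟩ ⟨G, hG⟩
    exact ⟨LinearMap.mul' ℚ ℚ ∘ₗ TensorProduct.map F G ∘ₗ (envComul 𝔤).toLinearMap,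
      fun w => coeff_mul_envWord gen w f g F G hF hG⟩
  add_mem' := by
    rintro f g ⟨F, hF⟩ ⟨G, hG⟩
    exact ⟨F + G, fun w => by simp [hF, hG]⟩
  algebraMap_mem' r := by
    classical
    refine ⟨r • (UniversalEnvelopingAlgebra.lift ℚ (0 : 𝔤 →ₗ⁅ℚ⁆ ℚ)).toLinearMap, fun w => ?_⟩
    rw [Algebra.algebraMap_eq_smul_one, map_smul, Sh.coeff_one, LinearMap.smul_apply,
      AlgHom.toLinearMap_apply]
    cases w with
    | nil => simp [envWord_nil]
    | cons a w =>
      rw [envWord_cons, map_mul, UniversalEnvelopingAlgebra.lift_ι_apply]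
      simp

lemma mem_coordRing {gen : X → 𝔤} {f : Sh X} : f ∈ coordRing gen ↔
    ∃ F : UniversalEnvelopingAlgebra ℚ 𝔤 →ₗ[ℚ] ℚ, ∀ w, Sh.coeff w f = F (envWord gen w) :=
  Iff.rfl

namespace coordRing

variable (gen : X → 𝔤)

/-- Contraction with a word in the right tensor factor. -/
def contrR (v : List X) : Sh X ⊗[ℚ] Sh X →ₗ[ℚ] Sh X :=
  (TensorProduct.rid ℚ (Sh X)).toLinearMap ∘ₗ (Sh.coeff v).lTensor (Sh X)

lemma coeff_contrR (u v : List X) (t : Sh X ⊗[ℚ] Sh X) :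
    Sh.coeff u (contrR v t) = Sh.coeff₂ u v t := by
  induction t with
  | zero => simp
  | add x y hx hy => simp [hx, hy]
  | tmul x y => simp [contrR, Sh.coeff₂_tmul, mul_comm]

lemma contrL_mem {f : Sh X} (hf : f ∈ coordRing gen) (u : List X) :
    Sh.contrL u (Sh.comulLin f) ∈ coordRing gen := by
  obtain ⟨F, hF⟩ := hf
  refine ⟨F ∘ₗ LinearMap.mulLeft ℚ (envWord gen u), fun w => ?_⟩
  rw [Sh.coeff_contrL, Sh.coeff₂_comulLin, hF, envWord_append]
  rfl

lemma contrR_mem {f : Sh X} (hf : f ∈ coordRing gen) (v : List X) :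
    contrR v (Sh.comulLin f) ∈ coordRing gen := by
  obtain ⟨F, hF⟩ := hf
  refine ⟨F ∘ₗ LinearMap.mulRight ℚ (envWord gen v), fun w => ?_⟩
  rw [coeff_contrR, Sh.coeff₂_comulLin, hF, envWord_append]
  rfl

/-- The inclusion of the coordinate ring in the shuffle algebra. -/
abbrev incl : coordRing gen →ₗ[ℚ] Sh X := (coordRing gen).val.toLinearMap

lemma incl_injective : Function.Injective (incl gen) := Subtype.val_injective

/-- A linear projection onto the coordinate ring. -/
def proj : Sh X →ₗ[ℚ] coordRing gen :=
  (LinearMap.exists_leftInverse_of_injective (incl gen)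
    (LinearMap.ker_eq_bot.2 (incl_injective gen))).choose

lemma proj_incl (f : coordRing gen) : proj gen (incl gen f) = f :=
  LinearMap.congr_fun (LinearMap.exists_leftInverse_of_injective (incl gen)
    (LinearMap.ker_eq_bot.2 (incl_injective gen))).choose_spec f

lemma incl_proj {f : Sh X} (hf : f ∈ coordRing gen) : incl gen (proj gen f) = f :=
  congrArg (incl gen) (proj_incl gen ⟨f, hf⟩)

/-- The coproduct of the coordinate ring, that is, the restriction of the deconcatenation coproduct
(see `map_incl_comulLin`; the choice of the projection is irrelevant). -/
def comulLin : coordRing gen →ₗ[ℚ] coordRing gen ⊗[ℚ] coordRing gen :=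
  TensorProduct.map (proj gen) (proj gen) ∘ₗ Sh.comulLin ∘ₗ incl gen

lemma map_incl_comulLin (f : coordRing gen) :
    TensorProduct.map (incl gen) (incl gen) (comulLin gen f) = Sh.comulLin (f : Sh X) := by
  have e1 : TensorProduct.map (incl gen ∘ₗ proj gen) LinearMap.id (Sh.comulLin (f : Sh X)) =
      Sh.comulLin (f : Sh X) := by
    refine Sh.ext_coeff₂ fun u v => ?_
    rw [← coeff_contrR, ← coeff_contrR, ← incl_proj gen (contrR_mem gen f.2 v)]
    congr 1
    generalize Sh.comulLin (f : Sh X) = t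
    induction t with
    | zero => simp
    | add x y hx hy => simp only [map_add, hx, hy]
    | tmul x y => simp [contrR]
  have e2 : TensorProduct.map LinearMap.id (incl gen ∘ₗ proj gen) (Sh.comulLin (f : Sh X)) =
      Sh.comulLin (f : Sh X) := by
    refine Sh.ext_coeff₂ fun u v => ?_
    rw [← Sh.coeff_contrL, ← Sh.coeff_contrL, ← incl_proj gen (contrL_mem gen f.2 u)]
    congr 1
    generalize Sh.comulLin (f : Sh X) = t
    induction t with
    | zero => simp
    | add x y hx hy => simp only [map_add, hx, hy]
    | tmul x y => simp [Sh.contrL]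
  have e3 : TensorProduct.map (incl gen) (incl gen) (comulLin gen f) =
      TensorProduct.map (incl gen ∘ₗ proj gen) LinearMap.id
        (TensorProduct.map LinearMap.id (incl gen ∘ₗ proj gen) (Sh.comulLin (f : Sh X))) := by
    rw [comulLin, LinearMap.comp_apply, LinearMap.comp_apply]
    change _ = TensorProduct.map _ _ (TensorProduct.map _ _ (Sh.comulLin (incl gen f)))
    generalize Sh.comulLin (incl gen f) = t
    induction t with
    | zero => simp
    | add x y hx hy => simp only [map_add, hx, hy]
    | tmul x y => simp
  rw [e3, e2, e1]

lemma map_incl_injective :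
    Function.Injective (TensorProduct.map (incl gen) (incl gen)) :=
  TensorProduct.map_injective_of_flat_flat _ _ (incl_injective gen) (incl_injective gen)

lemma map_incl_mul (s t : coordRing gen ⊗[ℚ] coordRing gen) :
    TensorProduct.map (incl gen) (incl gen) (s * t) =
      TensorProduct.map (incl gen) (incl gen) s * TensorProduct.map (incl gen) (incl gen) t :=
  map_mul (Algebra.TensorProduct.map (coordRing gen).val (coordRing gen).val) s t

/-- The coproduct of the coordinate ring as a homomorphism of algebras. -/
def comulHom : coordRing gen →ₐ[ℚ] coordRing gen ⊗[ℚ] coordRing gen :=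
  AlgHom.ofLinearMap (comulLin gen)
    (map_incl_injective gen (by
      rw [map_incl_comulLin]
      exact Sh.comulLin_one))
    (fun f g => map_incl_injective gen (by
      rw [map_incl_mul, map_incl_comulLin, map_incl_comulLin, map_incl_comulLin]
      exact Sh.comulLin_mul _ _))

/-- The counit of the coordinate ring: evaluation at the neutral element. -/
def counitHom : coordRing gen →ₐ[ℚ] ℚ := Sh.counitHom.comp (coordRing gen).val

lemma map_map_injective : Function.Injective
    (TensorProduct.map (incl gen) (TensorProduct.map (incl gen) (incl gen))) :=
  TensorProduct.map_injective_of_flat_flat _ _ (incl_injective gen) (map_incl_injective gen)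

lemma coassoc_aux (f : coordRing gen) :
    Algebra.TensorProduct.assoc ℚ ℚ ℚ (coordRing gen) (coordRing gen) (coordRing gen)
      (Algebra.TensorProduct.map (comulHom gen) (.id ℚ _) (comulLin gen f)) =
    Algebra.TensorProduct.map (.id ℚ _) (comulHom gen) (comulLin gen f) := by
  apply map_map_injective gen
  have h1 : ∀ t : coordRing gen ⊗[ℚ] coordRing gen,
      TensorProduct.map (incl gen) (TensorProduct.map (incl gen) (incl gen))
        (Algebra.TensorProduct.map (.id ℚ _) (comulHom gen) t) =
      Algebra.TensorProduct.map (.id ℚ _) Sh.comulHom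
        (TensorProduct.map (incl gen) (incl gen) t) := by
    intro t
    induction t with
    | zero => simp
    | add x y hx hy => simp only [map_add, hx, hy]
    | tmul x y =>
      simp only [Algebra.TensorProduct.map_tmul, TensorProduct.map_tmul]
      congr 1
      exact map_incl_comulLin gen y
  have h0 : ∀ (s : coordRing gen ⊗[ℚ] coordRing gen) (y : coordRing gen),
      TensorProduct.map (incl gen) (TensorProduct.map (incl gen) (incl gen))
        (Algebra.TensorProduct.assoc ℚ ℚ ℚ (coordRing gen) (coordRing gen) (coordRing gen)
          (s ⊗ₜ y)) =
      Algebra.TensorProduct.assoc ℚ ℚ ℚ (Sh X) (Sh X) (Sh X)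
        (TensorProduct.map (incl gen) (incl gen) s ⊗ₜ incl gen y) := by
    intro s y
    induction s with
    | zero => simp
    | add x z hx hz => simp only [TensorProduct.add_tmul, map_add, hx, hz]
    | tmul x z => simp
  have h2 : ∀ t : coordRing gen ⊗[ℚ] coordRing gen,
      TensorProduct.map (incl gen) (TensorProduct.map (incl gen) (incl gen))
        (Algebra.TensorProduct.assoc ℚ ℚ ℚ (coordRing gen) (coordRing gen) (coordRing gen)
          (Algebra.TensorProduct.map (comulHom gen) (.id ℚ _) t)) =
      Algebra.TensorProduct.assoc ℚ ℚ ℚ (Sh X) (Sh X) (Sh X)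
        (Algebra.TensorProduct.map Sh.comulHom (.id ℚ _)
          (TensorProduct.map (incl gen) (incl gen) t)) := by
    intro t
    induction t with
    | zero => simp
    | add x y hx hy => simp only [map_add, hx, hy]
    | tmul x y =>
      rw [Algebra.TensorProduct.map_tmul, h0, TensorProduct.map_tmul,
        Algebra.TensorProduct.map_tmul]
      congr 2
      exact map_incl_comulLin gen x
  rw [h1, h2, map_incl_comulLin]
  exact Sh.coassoc_aux _

/-- The coordinate ring as a bialgebra; its points form a group scheme (the antipode is unique and
not needed here). -/
instance : Bialgebra ℚ (coordRing gen) :=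
  Bialgebra.ofAlgHom (comulHom gen) (counitHom gen)
    (AlgHom.ext fun f => coassoc_aux gen f)
    (AlgHom.ext fun f => (Algebra.TensorProduct.lid ℚ _).injective (Subtype.ext (by
      have key : ∀ t : coordRing gen ⊗[ℚ] coordRing gen,
          ((Algebra.TensorProduct.lid ℚ _ (Algebra.TensorProduct.map (counitHom gen) (.id ℚ _) t) :
            coordRing gen) : Sh X) =
          Algebra.TensorProduct.lid ℚ _ (Algebra.TensorProduct.map Sh.counitHom (.id ℚ _)
            (TensorProduct.map (incl gen) (incl gen) t)) := by
        intro t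
        induction t with
        | zero => simp
        | add x y hx hy => simp only [map_add, Subalgebra.coe_add, hx, hy]
        | tmul x y => simp [counitHom]
      refine (key _).trans ?_
      refine (congrArg _ (congrArg _ (map_incl_comulLin gen f))).trans ?_
      simpa using Sh.lid_counit_comulLin (f : Sh X))))
    (AlgHom.ext fun f => (Algebra.TensorProduct.rid ℚ ℚ _).injective (Subtype.ext (by
      have key : ∀ t : coordRing gen ⊗[ℚ] coordRing gen,
          ((Algebra.TensorProduct.rid ℚ ℚ _ (Algebra.TensorProduct.map (.id ℚ _)
            (counitHom gen) t) : coordRing gen) : Sh X) =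
          Algebra.TensorProduct.rid ℚ ℚ _ (Algebra.TensorProduct.map (.id ℚ _) Sh.counitHom
            (TensorProduct.map (incl gen) (incl gen) t)) := by
        intro t
        induction t with
        | zero => simp
        | add x y hx hy => simp only [map_add, Subalgebra.coe_add, hx, hy]
        | tmul x y => simp [counitHom]
      refine (key _).trans ?_
      refine (congrArg _ (congrArg _ (map_incl_comulLin gen f))).trans ?_
      simpa using Sh.rid_counit_comulLin (f : Sh X))))

end coordRing

end CoordRing

section Polylog

/-- The alphabet `Γ = {e₁, e₁₁, e₂, e₂₂, e₁₂}`. -/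
inductive PLGen : Type
  | e1 | e11 | e2 | e22 | e12

/-- A free generator `e` of the free Lie algebra `L(Γ)`. -/
abbrev freeGen (a : PLGen) : FreeLieAlgebra ℚ PLGen := FreeLieAlgebra.of ℚ a

open PLGen in
/-- The defining relators: `[e₁,e₂] = [e₁₁,e₂] = [e₁,e₂₂] = 0` and
`[e₁₁,e₂₂] = -[e₁₁,e₁₂] = [e₂₂,e₁₂] = [e₂-e₁,e₁₂]`. -/
def plRelators : Set (FreeLieAlgebra ℚ PLGen) :=
  { ⁅freeGen e1, freeGen e2⁆,
    ⁅freeGen e11, freeGen e2⁆,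
    ⁅freeGen e1, freeGen e22⁆,
    ⁅freeGen e11, freeGen e22⁆ + ⁅freeGen e11, freeGen e12⁆,
    ⁅freeGen e11, freeGen e22⁆ - ⁅freeGen e22, freeGen e12⁆,
    ⁅freeGen e11, freeGen e22⁆ - ⁅freeGen e2 - freeGen e1, freeGen e12⁆ }

/-- The Lie algebra `L`: free on `Γ` modulo the relations. -/
abbrev LieL : Type :=
  FreeLieAlgebra ℚ PLGen ⧸ LieSubmodule.lieSpan ℚ (FreeLieAlgebra ℚ PLGen) plRelators

/-- The image of a generator in `L`. -/
def lGen (a : PLGen) : LieL := LieSubmodule.Quotient.mk (freeGen a)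

/-- The Lie ideal `N` of `L` generated by `e₁₁, e₂₂, e₁₂`. -/
def idealN : LieIdeal ℚ LieL :=
  LieSubmodule.lieSpan ℚ LieL {lGen .e11, lGen .e22, lGen .e12}

/-- The polylogarithmic Lie algebra `L^PL = L / [N, N]`. -/
abbrev LiePL : Type := LieL ⧸ ⁅idealN, idealN⁆

/-- The image of a generator in `L^PL`. -/
def plGen (a : PLGen) : LiePL := LieSubmodule.Quotient.mk (lGen a)

/-- `A^PL`, the coordinate ring of the prounipotent group `π^PL` of `L^PL`, inside the
shuffle algebra `A(Γ)`. -/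
abbrev APL : Subalgebra ℚ (Sh PLGen) := coordRing plGen

/-- For a noncommutative polynomial `x = ∑ aᵢ wᵢ` in the letters, `f_x = ∑ aᵢ f_{wᵢ}`; here a letter
acts on the shuffle algebra by prepending, and `x` is applied to the empty word. -/
def fPoly {X : Type*} (x : FreeAlgebra ℚ X) : Sh X :=
  FreeAlgebra.lift ℚ (A := Module.End ℚ (Sh X)) Sh.cons x (Sh.word [])

lemma fPoly_ι_mul {X : Type*} (a : X) (x : FreeAlgebra ℚ X) :
    fPoly (FreeAlgebra.ι ℚ a * x) = Sh.cons a (fPoly x) := by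
  simp [fPoly]

lemma fPoly_one {X : Type*} : fPoly (1 : FreeAlgebra ℚ X) = Sh.word [] := by
  simp [fPoly]

lemma fPoly_add {X : Type*} (x y : FreeAlgebra ℚ X) : fPoly (x + y) = fPoly x + fPoly y := by
  simp [fPoly]

/-- Index set of `Λ = Λ_{≥ -∞}`. -/
inductive Lam : Type
  | e1 : Lam
  | e2 : Lam
  /-- `e₁₁ e₁ᵏ` -/
  | l11 (k : ℕ) : Lam
  /-- `e₂₂ e₂ᵏ` -/
  | l22 (k : ℕ) : Lam
  /-- `e₁₂ (e₁ + e₂)ᵏ` -/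
  | l12 (k : ℕ) : Lam

namespace Lam

/-- The elements of `Λ` as noncommutative polynomials in the letters of `Γ`. -/
def poly : Lam → FreeAlgebra ℚ PLGen
  | e1 => FreeAlgebra.ι ℚ .e1
  | e2 => FreeAlgebra.ι ℚ .e2
  | l11 k => FreeAlgebra.ι ℚ .e11 * FreeAlgebra.ι ℚ .e1 ^ k
  | l22 k => FreeAlgebra.ι ℚ .e22 * FreeAlgebra.ι ℚ .e2 ^ k
  | l12 k => FreeAlgebra.ι ℚ .e12 * (FreeAlgebra.ι ℚ .e1 + FreeAlgebra.ι ℚ .e2) ^ k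

/-- The half-weight, normalized to be positive. -/
def wt : Lam → ℕ
  | e1 => 1
  | e2 => 1
  | l11 k => k + 1
  | l22 k => k + 1
  | l12 k => k + 1

end Lam

attribute [local instance] LieRing.ofAssociativeRing

/-- A Lie algebra homomorphism out of a quotient. -/
def quotLift {L L' : Type*} [LieRing L] [LieAlgebra ℚ L] [LieRing L'] [LieAlgebra ℚ L']
    (I : LieIdeal ℚ L) (φ : L →ₗ⁅ℚ⁆ L') (h : I ≤ φ.ker) : (L ⧸ I) →ₗ⁅ℚ⁆ L' :=
  { I.toSubmodule.liftQ (φ : L →ₗ[ℚ] L') (fun x hx => (LieHom.mem_ker).1 (h hx)) with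
    map_lie' := by
      intro x y
      obtain ⟨x, rfl⟩ := Submodule.Quotient.mk_surjective _ x
      obtain ⟨y, rfl⟩ := Submodule.Quotient.mk_surjective _ y
      exact φ.map_lie x y }

lemma quotLift_mk {L L' : Type*} [LieRing L] [LieAlgebra ℚ L] [LieRing L'] [LieAlgebra ℚ L']
    (I : LieIdeal ℚ L) (φ : L →ₗ⁅ℚ⁆ L') (h : I ≤ φ.ker) (x : L) :
    quotLift I φ h (LieSubmodule.Quotient.mk x) = φ x := rfl

open Polynomial Matrix

/-- The `2 × 2` matrices over `ℚ[t]` with vanishing first column. -/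
def colAlg : LieSubalgebra ℚ (Matrix (Fin 2) (Fin 2) ℚ[X]) where
  carrier := {A | A 0 0 = 0 ∧ A 1 0 = 0}
  add_mem' := by
    rintro A B ⟨h1, h2⟩ ⟨h3, h4⟩
    exact ⟨by simp [h1, h3], by simp [h2, h4]⟩
  zero_mem' := ⟨rfl, rfl⟩
  smul_mem' := by
    rintro r A ⟨h1, h2⟩
    exact ⟨by simp [h1], by simp [h2]⟩
  lie_mem' := by
    rintro A B ⟨h1, h2⟩ ⟨h3, h4⟩
    constructor <;>
      simp [LieRing.of_associative_ring_bracket, Matrix.mul_apply, h1, h2, h3, h4]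

/-- The element of `colAlg` with second column `(q, p)`. -/
def colElt (q p : ℚ[X]) : colAlg := ⟨!![0, q; 0, p], by constructor <;> rfl⟩

lemma colElt_lie (q p q' p' : ℚ[X]) :
    ⁅colElt q p, colElt q' p'⁆ = colElt (q * p' - q' * p) 0 := by
  apply Subtype.ext
  rw [LieSubalgebra.coe_bracket, LieRing.of_associative_ring_bracket]
  simp only [colElt]
  ext i j
  fin_cases i <;> fin_cases j <;> simp [mul_comm]

lemma colElt_zero : colElt 0 0 = 0 := by
  apply Subtype.ext
  ext i j
  fin_cases i <;> fin_cases j <;> simp [colElt]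

lemma colElt_add (q p q' p' : ℚ[X]) : colElt q p + colElt q' p' = colElt (q + q') (p + p') := by
  apply Subtype.ext
  ext i j
  fin_cases i <;> fin_cases j <;> simp [colElt]

lemma colElt_sub (q p q' p' : ℚ[X]) : colElt q p - colElt q' p' = colElt (q - q') (p - p') := by
  apply Subtype.ext
  ext i j
  fin_cases i <;> fin_cases j <;> simp [colElt]

lemma colAlg_eq (A : colAlg) : A = colElt (A.1 0 1) (A.1 1 1) := by
  obtain ⟨A, h1, h2⟩ := A
  apply Subtype.ext
  ext i j
  fin_cases i <;> fin_cases j <;> simp [colElt, h1, h2]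

/-- The abelian ideal of strictly upper triangular matrices. -/
def colIdeal : LieIdeal ℚ colAlg where
  carrier := {A | A.1 1 1 = 0}
  add_mem' := by
    intro A B (h1 : A.1 1 1 = 0) (h2 : B.1 1 1 = 0)
    change (A + B).1 1 1 = 0
    simp [h1, h2]
  zero_mem' := rfl
  smul_mem' := by
    intro r A (h : A.1 1 1 = 0)
    change (r • A).1 1 1 = 0
    simp [h]
  lie_mem := by
    intro A B (_ : B.1 1 1 = 0)
    change (⁅A, B⁆).1 1 1 = 0
    rw [colAlg_eq A, colAlg_eq B, colElt_lie]
    rfl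

lemma exists_lieHom (q p : PLGen → ℚ[X]) (h11 : p .e11 = 0) (h22 : p .e22 = 0) (h12 : p .e12 = 0)
    (r1 : q .e1 * p .e2 = q .e2 * p .e1) (r2 : q .e11 * p .e2 = 0) (r3 : q .e22 * p .e1 = 0)
    (r4 : q .e12 * (p .e2 - p .e1) = 0) :
    ∃ φ : LiePL →ₗ⁅ℚ⁆ Matrix (Fin 2) (Fin 2) ℚ[X],
      ∀ a, φ (plGen a) = !![0, q a; 0, p a] := by
  let φ₀ : FreeLieAlgebra ℚ PLGen →ₗ⁅ℚ⁆ colAlg :=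
    FreeLieAlgebra.lift ℚ fun a => colElt (q a) (p a)
  have hφ₀ : ∀ a, φ₀ (freeGen a) = colElt (q a) (p a) := fun a =>
    FreeLieAlgebra.lift_of_apply _ a
  have k₀ : LieSubmodule.lieSpan ℚ (FreeLieAlgebra ℚ PLGen) plRelators ≤ φ₀.ker := by
    rw [LieSubmodule.lieSpan_le]
    intro x hx
    simp only [plRelators, Set.mem_insert_iff, Set.mem_singleton_iff] at hx
    rw [SetLike.mem_coe, LieHom.mem_ker]
    rcases hx with rfl | rfl | rfl | rfl | rfl | rfl <;>
      simp only [map_add, map_sub, LieHom.map_lie, hφ₀, colElt_lie, colElt_add, colElt_sub,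
        ← colElt_zero] <;> congr 1
    · rw [r1, sub_self]
    · rw [r2, h11]; ring
    · rw [h22]; linear_combination -r3
    · rw [h11, h12, h22]; ring
    · ring
    · rw [h11, h12, h22]; ring
    · ring
    · rw [h11, h12, h22]; linear_combination r4
    · ring
  let φ₁ : LieL →ₗ⁅ℚ⁆ colAlg := quotLift _ φ₀ k₀
  have hφ₁ : ∀ a, φ₁ (lGen a) = colElt (q a) (p a) := fun a => hφ₀ a
  have hN : idealN ≤ colIdeal.comap φ₁ := by
    rw [idealN, LieSubmodule.lieSpan_le]
    intro x hx
    rw [SetLike.mem_coe, LieIdeal.mem_comap]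
    rcases hx with rfl | rfl | rfl <;> rw [hφ₁]
    exacts [h11, h22, h12]
  have k₁ : ⁅idealN, idealN⁆ ≤ φ₁.ker := by
    rw [LieSubmodule.lieIdeal_oper_eq_span, LieSubmodule.lieSpan_le]
    rintro _ ⟨⟨x, hx⟩, ⟨y, hy⟩, rfl⟩
    rw [SetLike.mem_coe, LieHom.mem_ker]
    have h1 : (φ₁ x).1 1 1 = 0 := hN hx
    have h2 : (φ₁ y).1 1 1 = 0 := hN hy
    change φ₁ ⁅x, y⁆ = 0
    rw [LieHom.map_lie, colAlg_eq (φ₁ x), colAlg_eq (φ₁ y), h1, h2, colElt_lie, ← colElt_zero]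
    congr 1
    ring
  exact ⟨colAlg.incl.comp (quotLift _ φ₁ k₁), fun a => congrArg Subtype.val (hφ₁ a)⟩

/-- A word function given by a triangular `2 × 2` representation factors through `L^PL`. -/
lemma mem_APL (q p : PLGen → ℚ[X]) (h11 : p .e11 = 0) (h22 : p .e22 = 0) (h12 : p .e12 = 0)
    (r1 : q .e1 * p .e2 = q .e2 * p .e1) (r2 : q .e11 * p .e2 = 0) (r3 : q .e22 * p .e1 = 0)
    (r4 : q .e12 * (p .e2 - p .e1) = 0) (n : ℕ) (f : Sh PLGen)
    (hnil : Sh.coeff [] f = 0)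
    (hf : ∀ a w, Sh.coeff (a :: w) f = (q a * (w.map p).prod).coeff n) : f ∈ APL := by
  obtain ⟨φ, hφ⟩ := exists_lieHom q p h11 h22 h12 r1 r2 r3 r4
  refine ⟨(Polynomial.lcoeff ℚ n) ∘ₗ Matrix.entryLinearMap ℚ ℚ[X] (0 : Fin 2) (1 : Fin 2) ∘ₗ
    (UniversalEnvelopingAlgebra.lift ℚ φ).toLinearMap, fun w => ?_⟩
  have key : ∀ w : List PLGen,
      (UniversalEnvelopingAlgebra.lift ℚ φ (envWord plGen w)) 1 0 = 0 ∧
      (UniversalEnvelopingAlgebra.lift ℚ φ (envWord plGen w)) 1 1 = (w.map p).prod := by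
    intro w
    induction w with
    | nil => simp [envWord_nil]
    | cons a w ih =>
      rw [envWord_cons, map_mul, UniversalEnvelopingAlgebra.lift_ι_apply, hφ]
      simp [Matrix.mul_apply, ih.1, ih.2]
  cases w with
  | nil => simp [envWord_nil, hnil]
  | cons a w =>
    rw [hf, envWord_cons]
    simp only [LinearMap.comp_apply, AlgHom.toLinearMap_apply, map_mul,
      UniversalEnvelopingAlgebra.lift_ι_apply, hφ, Matrix.entryLinearMap_apply,
      Polynomial.lcoeff_apply]
    simp [Matrix.mul_apply, (key w).2]

open Classical in
lemma coeff_cons_cons {X : Type*} (a b : X) (w : List X) (f : Sh X) :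
    Sh.coeff (b :: w) (Sh.cons a f) = if a = b then Sh.coeff w f else 0 := by
  suffices h : (Sh.coeff (b :: w)).comp (Sh.cons a) = if a = b then Sh.coeff w else 0 by
    have := congrArg (· f) h
    split_ifs at this ⊢ <;> simpa using this
  refine Sh.hom_ext fun u => ?_
  rw [LinearMap.comp_apply, Sh.cons_word, Sh.coeff_word]
  split_ifs <;> simp_all [Sh.coeff_word]

lemma coeff_nil_cons {X : Type*} (a : X) (f : Sh X) : Sh.coeff [] (Sh.cons a f) = 0 := by
  classical
  suffices h : (Sh.coeff []).comp (Sh.cons a) = 0 from congrArg (· f) h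
  refine Sh.hom_ext fun u => ?_
  rw [LinearMap.comp_apply, Sh.cons_word, Sh.coeff_word]
  simp

open Classical in
/-- The coefficients of `(∑_{a ∈ S} a)ⁿ`. -/
lemma coeff_fPoly_pow {X : Type*} (S : Finset X) (n : ℕ) (w : List X) :
    Sh.coeff w (fPoly ((∑ a ∈ S, FreeAlgebra.ι ℚ a) ^ n)) =
      ((w.map fun a => if a ∈ S then (Polynomial.X : ℚ[X]) else 0).prod).coeff n := by
  have hsum : ∀ x : FreeAlgebra ℚ X, fPoly ((∑ a ∈ S, FreeAlgebra.ι ℚ a) * x) =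
      ∑ a ∈ S, Sh.cons a (fPoly x) := by
    intro x
    simp [fPoly, LinearMap.sum_apply]
  induction n generalizing w with
  | zero =>
    rw [pow_zero, fPoly_one, Sh.coeff_word]
    cases w with
    | nil => simp
    | cons a w => by_cases h : a ∈ S <;> simp [h]
  | succ n ih =>
    rw [pow_succ', hsum, map_sum]
    cases w with
    | nil => simp [coeff_nil_cons, Polynomial.coeff_one]
    | cons a w =>
      simp only [coeff_cons_cons, Finset.sum_ite_eq', ih]
      by_cases h : a ∈ S <;> simp [h]

/-- The functions `f_λ`, for `λ ∈ Λ`, belong to `A^PL`. -/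
lemma fPoly_mem_APL (l : Lam) : fPoly l.poly ∈ APL := by
  classical
  have main : ∀ (b : PLGen) (S : Finset PLGen) (n : ℕ), (.e11 ∉ S) → (.e22 ∉ S) → (.e12 ∉ S) →
      (b = .e1 → .e2 ∉ S) → (b = .e2 → .e1 ∉ S) → (b = .e11 → .e2 ∉ S) → (b = .e22 → .e1 ∉ S) →
      (b = .e12 → (PLGen.e1 ∈ S ↔ PLGen.e2 ∈ S)) →
      fPoly (FreeAlgebra.ι ℚ b * (∑ a ∈ S, FreeAlgebra.ι ℚ a) ^ n) ∈ APL := by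
    intro b S n h1 h2 h3 h4 h5 h6 h7 h8
    refine mem_APL (fun a => if b = a then 1 else 0)
      (fun a => if a ∈ S then (Polynomial.X : ℚ[X]) else 0) (by simp [h1]) (by simp [h2])
      (by simp [h3]) ?_ ?_ ?_ ?_ n _ ?_ ?_
    · cases b <;> simp_all
    · cases b <;> simp_all
    · cases b <;> simp_all
    · cases b <;> simp_all
    · rw [fPoly_ι_mul, coeff_nil_cons]
    · intro a w
      rw [fPoly_ι_mul, coeff_cons_cons, coeff_fPoly_pow]
      split_ifs <;> simp
  cases l with
  | e1 => simpa [Lam.poly] using main .e1 ∅ 0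
  | e2 => simpa [Lam.poly] using main .e2 ∅ 0
  | l11 k => simpa [Lam.poly] using main .e11 {.e1} k
  | l22 k => simpa [Lam.poly] using main .e22 {.e2} k
  | l12 k => simpa [Lam.poly] using main .e12 {.e1, .e2} k

/-- The function `f_λ` on `π^PL`. -/
def fLam (l : Lam) : APL := ⟨fPoly l.poly, fPoly_mem_APL l⟩

end Polylog

section Cocycles

/-- The half-weight of a word, for letters of half-weights `ω`. -/
def wordWt {X : Type*} (ω : X → ℕ) (w : List X) : ℕ := (w.map ω).sum

/-- The part of degree (half-weight) `n` of the shuffle algebra. -/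
def Sh.homog {X : Type*} (ω : X → ℕ) (n : ℕ) : Submodule ℚ (Sh X) :=
  Submodule.span ℚ {f | ∃ w, wordWt ω w = n ∧ f = Sh.word w}

/-- The part of degree `n` of `A^PL`; all letters of `Γ` have half-weight one. -/
def APL.homog (n : ℕ) : Submodule ℚ APL :=
  (Sh.homog (fun _ : PLGen => 1) n).comap APL.val.toLinearMap

/-- The graded set `Σ = Σ₋₁ ∪ ⋯ ∪ Σ₋ₙ`, where `N` is the bound: `Σ₋₁ = T` is arbitrary, and there is
one generator `σ_m` of weight `-m` for every odd `m` with `3 ≤ m ≤ N`. -/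
inductive Gens (T : Type*) (N : ℕ) : Type _
  | tau (t : T) : Gens T N
  | sigma (m : ℕ) (odd : Odd m) (three_le : 3 ≤ m) (le : m ≤ N) : Gens T N

/-- The half-weight of a generator, normalized to be positive. -/
def Gens.wt {T : Type*} {N : ℕ} : Gens T N → ℕ
  | tau _ => 1
  | sigma m _ _ _ => m

universe u v

variable {R : Type u} [CommRing R]

/-- The product of two `S`-valued points of the group scheme `Spec A`. -/
def pointMul {A : Type*} [CommRing A] [Bialgebra R A] {S : Type*} [CommRing S] [Algebra R S]
    (γ γ' : A →ₐ[R] S) : A →ₐ[R] S :=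
  (Algebra.TensorProduct.lift γ γ' fun _ _ => Commute.all _ _).comp (Bialgebra.comulAlgHom R A)

variable [Algebra ℚ R]

variable (R) in
/-- A `𝔾_m`-equivariant `R`-cocycle `c : π(Σ)_R → π^PL_R`, for the trivial action of
`π(Σ)` on `π^PL`. The coordinate ring of the free prounipotent group `π(Σ)` is the shuffle algebra
on `Σ`. A morphism `c` of schemes over `R` is a homomorphism `c♯` of coordinate rings
in the other direction. The cocycle condition for the trivial action is
`c(γγ') = c(γ) c(γ')` for points `γ, γ'` with values in `R`-algebras. Equivariance under the
`𝔾_m`-actions that define the gradings means that `c♯` preserves degrees. -/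
@[ext]
structure Cocycle (T : Type v) (N : ℕ) where
  /-- The homomorphism `c♯` of coordinate rings. -/
  sharp : R ⊗[ℚ] APL →ₐ[R] R ⊗[ℚ] Sh (Gens T N)
  map_pointMul : ∀ (S : Type (max u v)) [CommRing S] [Algebra R S]
    (γ γ' : R ⊗[ℚ] Sh (Gens T N) →ₐ[R] S),
    (pointMul γ γ').comp sharp = pointMul (γ.comp sharp) (γ'.comp sharp)
  equivariant : ∀ n : ℕ, ∀ f ∈ APL.homog n,
    sharp (1 ⊗ₜ f) ∈ (Sh.homog (Gens.wt (T := T) (N := N)) n).baseChange R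

/-- The pairing `⟨-, w⟩` with a word on `R ⊗ A`: the coefficient of `f_w`. -/
def pairing {X : Type*} (w : List X) : R ⊗[ℚ] Sh X →ₗ[R] R :=
  (TensorProduct.AlgebraTensorModule.rid ℚ R R).toLinearMap ∘ₗ (Sh.coeff w).baseChange R

/-- `φ^w_f(c) = ⟨c♯ f, w⟩`, for a function `f` on `π^PL`. -/
def Cocycle.phi {T : Type v} {N : ℕ} (c : Cocycle R T N) (f : APL) (w : List (Gens T N)) : R :=
  pairing w (c.sharp (1 ⊗ₜ f))

end Cocycles

end

/-! For the trivial action a cocycle is a homomorphism of group schemes. Its coefficient at a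
one-letter word `ρ` is therefore a derivation of A^PL at the counit, homogeneous of degree the
weight of `ρ`: an element of the Lie algebra with coefficients in `R`. Since π(Σ) is free, these
elements can be prescribed freely and determine the homomorphism. What remains is to see that the
functions f_λ of weight m are coordinates on the degree m part of the Lie algebra, and to compute
the coefficients at longer words.

Modulo [N,N] the ideal N becomes abelian, e₁ and e₂ commute, and [e₁₂,e₂] = [e₁₂,e₁]. Hence e₁, e₂
and the iterated brackets of e₁₁ with e₁, of e₂₂ with e₂ and of e₁₂ with e₁ have a span that
contains the generators and is stable under bracketing with them (`Lam.lieElt_lie_mem`). Dually,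
each λ gives an operator ∂_λ on A^PL, an iterated commutator of deletions of initial letters, and
ε(∂_μ f_λ) is the Kronecker delta (`eps_der_fLam`).

The f_λ determine a homogeneous derivation D at the counit by a Dynkin argument. Let S be the
antipode and E the Euler operator, which multiplies a word by its length. The coefficients of the
convolution S * E applied to f are ε of iterated commutators of deletions applied to f, that is,
values of f on iterated brackets. So (S * E) f = 0 as soon as ε(∂_λ f) = 0 for all λ
(`twist_euler_APL`). Applying D gives D(E f) = 0, hence n D(f) = 0 in degree n, and n is invertible
for n ≥ 1. Therefore D(f) = ∑ ε(∂_λ f) D(f_λ) (`APL.derivation_eq_sum`).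

Splitting off the first letter of a word then gives the recursion `Cocycle.phi_cons`: φ^{ρw}(f) =
∑_λ φ^ρ(f_λ) φ^w(∂_λ f), with λ of the weight of ρ. Uniqueness in (b) is immediate. For (a), ∂_μ
turns e_b xᵏ into a power of x (x = e₁, e₂ or e₁ + e₂) or kills it, and on powers of x only ∂_{e₁}
and ∂_{e₂} act; so the first letter is arbitrary and every later letter contributes a factor φ_x,
which vanishes outside weight 1.

For existence the recursion is read as a definition, on the whole shuffle algebra on Γ: the
homomorphism is first built into the free prounipotent group on Γ and then restricted to A^PL.
Multiplicativity holds because each ∂_λ is a derivation, and compatibility with coproducts because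
∂_λ acts on the left tensor factor of the coproduct. -/

noncomputable section

/-! ### Derivations, antipode, Euler operator and length grading of the shuffle algebra. -/

namespace Sh

variable {X : Type*}

/-- Deletion of an initial letter, as a derivation of the shuffle algebra. -/
def delDer (a : X) : Derivation ℚ (Sh X) (Sh X) :=
  Derivation.mk' (del a) fun f g => by
    rw [del_mul, smul_eq_mul, smul_eq_mul, mul_comm (del a f), add_comm]

lemma delDer_apply (a : X) (f : Sh X) : delDer a f = del a f := rfl

/-- The iterated commutator `ad(del b)ᵏ (del a)`. -/
def adIter (b a : X) : ℕ → Derivation ℚ (Sh X) (Sh X)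
  | 0 => delDer a
  | k + 1 => ⁅delDer b, adIter b a k⁆

lemma adIter_succ_apply (b a : X) (k : ℕ) (f : Sh X) :
    adIter b a (k + 1) f = del b (adIter b a k f) - adIter b a k (del b f) := by
  rw [adIter, Derivation.commutator_apply]; rfl

/-- `f` is supported on words of length `n`. -/
def IsLen (n : ℤ) (f : Sh X) : Prop := ∀ w, (w.length : ℤ) ≠ n → coeff w f = 0

lemma IsLen.del {n : ℤ} {f : Sh X} (h : IsLen n f) (a : X) : IsLen (n - 1) (del a f) := by
  intro w hw
  rw [coeff_del]
  apply h
  simp only [List.length_cons]; push_cast; omega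

lemma IsLen.sub {n : ℤ} {f g : Sh X} (hf : IsLen n f) (hg : IsLen n g) : IsLen n (f - g) := by
  intro w hw
  rw [map_sub, hf w hw, hg w hw, sub_zero]

/-- Each of the k + 1 deletions removes one letter. Lengths are integers so that the difference does
not truncate: a negative length simply forces the function to vanish. -/
lemma IsLen.adIter {f : Sh X} (b a : X) (k : ℕ) {n : ℤ} (h : IsLen n f) :
    IsLen (n - (k + 1)) (adIter b a k f) := by
  induction k generalizing n f with
  | zero => simpa [Sh.adIter, delDer_apply] using h.del a
  | succ k ih =>
    rw [adIter_succ_apply]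
    refine IsLen.sub ?_ ?_
    · convert (ih h).del b using 1; push_cast; ring
    · convert ih (h.del b) using 1; push_cast; ring

lemma isLen_word (w : List X) : IsLen w.length (word w) := by
  classical
  intro u hu
  rw [coeff_word, if_neg]
  rintro rfl
  exact hu rfl

lemma mem_homog_iff (ω : X → ℕ) (n : ℕ) (f : Sh X) :
    f ∈ homog ω n ↔ ∀ w, wordWt ω w ≠ n → coeff w f = 0 := by
  classical
  constructor
  · intro h w hw
    have : homog ω n ≤ LinearMap.ker (coeff w) := by
      rw [homog, Submodule.span_le]
      rintro _ ⟨u, hu, rfl⟩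
      rw [SetLike.mem_coe, LinearMap.mem_ker, coeff_word, if_neg]
      rintro rfl
      exact hw hu
    exact this h
  · intro h
    rw [← basis.linearCombination_repr f, Finsupp.linearCombination_apply]
    refine Submodule.sum_mem _ fun w hw => Submodule.smul_mem _ _ ?_
    rw [basis_apply]
    refine Submodule.subset_span ⟨w, ?_, rfl⟩
    by_contra hne
    exact Finsupp.mem_support_iff.1 hw (h w hne)

lemma wordWt_one (w : List X) : wordWt (fun _ : X => 1) w = w.length := by
  simp [wordWt]

lemma mem_homog_one_iff (n : ℕ) (f : Sh X) : f ∈ homog (fun _ : X => 1) n ↔ IsLen n f := by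
  rw [mem_homog_iff]
  simp [wordWt_one, IsLen]

/-- The Euler operator: multiplication by the length on each word. -/
def euler : Sh X →ₗ[ℚ] Sh X := basis.constr ℚ fun w => (w.length : ℚ) • word w

lemma euler_word (w : List X) : euler (word w) = (w.length : ℚ) • word w := by
  rw [euler, ← basis_apply, Module.Basis.constr_basis, basis_apply]

lemma coeff_euler (w : List X) (f : Sh X) : coeff w (euler f) = w.length * coeff w f := by
  classical
  suffices h : (coeff w).comp euler = (w.length : ℚ) • coeff w from congrArg (· f) h
  refine hom_ext fun u => ?_
  rw [LinearMap.comp_apply, euler_word, map_smul, LinearMap.smul_apply, coeff_word]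
  split_ifs with h <;> simp [h]

/-- The antipode. -/
def anti : Sh X →ₗ[ℚ] Sh X := basis.constr ℚ fun w => (-1 : ℚ) ^ w.length • word w.reverse

lemma anti_word (w : List X) : anti (word w) = (-1 : ℚ) ^ w.length • word w.reverse := by
  rw [anti, ← basis_apply, Module.Basis.constr_basis]

lemma coeff_anti (w : List X) (f : Sh X) :
    coeff w (anti f) = (-1 : ℚ) ^ w.length * coeff w.reverse f := by
  classical
  suffices h : (coeff w).comp anti = (-1 : ℚ) ^ w.length • coeff w.reverse from congrArg (· f) h
  refine hom_ext fun u => ?_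
  rw [LinearMap.comp_apply, anti_word, map_smul, LinearMap.smul_apply, coeff_word, coeff_word]
  by_cases h : u.reverse = w
  · subst h; simp
  · rw [if_neg h, if_neg (fun h' => h (by rw [h', List.reverse_reverse]))]; simp

/-- Scaling of each word by the power of `t` given by the length. -/
def scale (t : ℚ) : Sh X →ₗ[ℚ] Sh X := basis.constr ℚ fun w => t ^ w.length • word w

lemma coeff_scale (t : ℚ) (w : List X) (f : Sh X) :
    coeff w (scale t f) = t ^ w.length * coeff w f := by
  classical
  suffices h : (coeff w).comp (scale t) = t ^ w.length • coeff w from congrArg (· f) h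
  refine hom_ext fun u => ?_
  rw [LinearMap.comp_apply, scale, ← basis_apply, Module.Basis.constr_basis, map_smul,
    LinearMap.smul_apply, basis_apply, coeff_word]
  split_ifs with h <;> simp [h]

/-- Projection to the words of length `n`. -/
def comp (n : ℕ) : Sh X →ₗ[ℚ] Sh X :=
  basis.constr ℚ fun w => if w.length = n then word w else 0

lemma coeff_comp (n : ℕ) (w : List X) (f : Sh X) :
    coeff w (comp n f) = if w.length = n then coeff w f else 0 := by
  classical
  suffices h : (coeff w).comp (comp n) = if w.length = n then coeff w else 0 by
    have := congrArg (· f) h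
    split_ifs at this ⊢ <;> simpa using this
  refine hom_ext fun u => ?_
  rw [LinearMap.comp_apply, comp, ← basis_apply, Module.Basis.constr_basis, basis_apply]
  by_cases h : u = w
  · subst h; split_ifs <;> simp
  · split_ifs <;> simp [coeff_word, h]

lemma exists_bound (f : Sh X) : ∃ d : ℕ, ∀ w, d ≤ w.length → coeff w f = 0 := by
  refine ⟨(toFinsupp f).support.sup List.length + 1, fun w hw => ?_⟩
  by_contra h
  have : w ∈ (toFinsupp f).support := Finsupp.mem_support_iff.2 h
  have := Finset.le_sup (f := List.length) this
  omega

lemma sum_comp (f : Sh X) (d : ℕ) (hd : ∀ w, d ≤ w.length → coeff w f = 0) :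
    ∑ n ∈ Finset.range d, comp n f = f := by
  refine ext_coeff fun w => ?_
  rw [map_sum]
  simp only [coeff_comp, Finset.sum_ite_eq, Finset.mem_range]
  split_ifs with h
  · rfl
  · exact (hd w (by omega)).symm

lemma scale_eq_sum (t : ℚ) (f : Sh X) (d : ℕ) (hd : ∀ w, d ≤ w.length → coeff w f = 0) :
    scale t f = ∑ n ∈ Finset.range d, t ^ n • comp n f := by
  refine ext_coeff fun w => ?_
  rw [map_sum]
  simp only [map_smul, coeff_comp, coeff_scale, smul_eq_mul, mul_ite, mul_zero,
    Finset.sum_ite_eq, Finset.mem_range]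
  split_ifs with h
  · rfl
  · rw [hd w (by omega), mul_zero]

/-- A subspace stable under scaling contains the homogeneous components of its elements. -/
lemma comp_mem_of_scale (W : Submodule ℚ (Sh X)) (f : Sh X) (h : ∀ t : ℚ, scale t f ∈ W) (n : ℕ) :
    comp n f ∈ W := by
  obtain ⟨d, hd⟩ := exists_bound f
  by_cases hn : n < d
  swap
  · convert W.zero_mem
    refine ext_coeff fun w => ?_
    rw [coeff_comp, map_zero]
    split_ifs with h1
    · exact hd w (by omega)
    · rfl
  -- A nonzero class modulo `W` is detected by a linear functional `L`. Along the scalings of `f`,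
  -- `L` is a polynomial in `t` whose coefficients are the values on the components; it vanishes at
  -- every rational `t`, so every coefficient is zero.
  rw [← Submodule.Quotient.mk_eq_zero]
  by_contra hne
  rw [← Module.forall_dual_apply_eq_zero_iff ℚ] at hne
  push Not at hne
  obtain ⟨L, hL⟩ := hne
  let P : Polynomial ℚ := ∑ i ∈ Finset.range d,
    Polynomial.monomial i (L (Submodule.Quotient.mk (comp i f)))
  have hP : P = 0 := by
    refine Polynomial.funext fun t => ?_
    have h1 : L (W.mkQ (scale t f)) = 0 := by
      rw [(Submodule.Quotient.mk_eq_zero W).2 (h t) |> fun h => (h : W.mkQ _ = 0), map_zero]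
    rw [scale_eq_sum t f d hd, map_sum, map_sum] at h1
    rw [Polynomial.eval_finsetSum, Polynomial.eval_zero, ← h1]
    refine Finset.sum_congr rfl fun i _ => ?_
    rw [Polynomial.eval_monomial, map_smul, map_smul, smul_eq_mul, mul_comm]
    rfl
  apply hL
  have := congrArg (fun p => Polynomial.coeff p n) hP
  simpa [P, Polynomial.finsetSum_coeff, Polynomial.coeff_monomial, hn] using this

end Sh

/-! ### Operators on a coordinate ring that come from the enveloping algebra. -/

section CoordRingOperations

attribute [local instance] LieRing.ofAssociativeRing

variable {𝔤 : Type*} [LieRing 𝔤] [LieAlgebra ℚ 𝔤] {X : Type*} (gen : X → 𝔤)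

/-- The antipode of the universal enveloping algebra. -/
def envAnti (𝔤 : Type*) [LieRing 𝔤] [LieAlgebra ℚ 𝔤] :
    UniversalEnvelopingAlgebra ℚ 𝔤 →ₐ[ℚ] (UniversalEnvelopingAlgebra ℚ 𝔤)ᵐᵒᵖ :=
  UniversalEnvelopingAlgebra.lift ℚ
    { toFun := fun x => MulOpposite.op (-UniversalEnvelopingAlgebra.ι ℚ x)
      map_add' := fun x y => by simp [add_comm]
      map_smul' := fun r x => by simp
      map_lie' := fun {x y} => by
        simp only [LieHom.map_lie, LieRing.of_associative_ring_bracket, ← MulOpposite.op_mul,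
          ← MulOpposite.op_sub]
        congr 1
        noncomm_ring }

lemma envAnti_envWord (w : List X) : envAnti 𝔤 (envWord gen w) =
    MulOpposite.op ((-1 : ℚ) ^ w.length • envWord gen w.reverse) := by
  induction w with
  | nil => simp [envWord_nil]
  | cons a w ih =>
    have : envAnti 𝔤 (UniversalEnvelopingAlgebra.ι ℚ (gen a)) =
        MulOpposite.op (-UniversalEnvelopingAlgebra.ι ℚ (gen a)) :=
      UniversalEnvelopingAlgebra.lift_ι_apply ℚ _ _
    rw [envWord_cons, map_mul, ih, this, ← MulOpposite.op_mul, List.reverse_cons, envWord_append,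
      envWord_cons, envWord_nil, List.length_cons, pow_succ]
    simp

/-- The signed reversal of words is dual to the antipode of the enveloping algebra, so the
functional is composed with the latter. -/
lemma anti_mem_coordRing {f : Sh X} (hf : f ∈ coordRing gen) : Sh.anti f ∈ coordRing gen := by
  obtain ⟨F, hF⟩ := hf
  refine ⟨F ∘ₗ (MulOpposite.opLinearEquiv ℚ).symm.toLinearMap ∘ₗ (envAnti 𝔤).toLinearMap,
    fun w => ?_⟩
  rw [Sh.coeff_anti, hF]
  simp [envAnti_envWord]

/-- Deleting an initial letter is dual to left multiplication by the corresponding generator. -/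
lemma del_mem_coordRing {f : Sh X} (hf : f ∈ coordRing gen) (a : X) :
    Sh.del a f ∈ coordRing gen := by
  obtain ⟨F, hF⟩ := hf
  exact ⟨F ∘ₗ LinearMap.mulLeft ℚ (UniversalEnvelopingAlgebra.ι ℚ (gen a)),
    fun u => by rw [Sh.coeff_del, hF, envWord_cons]; rfl⟩

lemma adIter_mem_coordRing {f : Sh X} (hf : f ∈ coordRing gen) (b a : X) (k : ℕ) :
    Sh.adIter b a k f ∈ coordRing gen := by
  induction k generalizing f with
  | zero => exact del_mem_coordRing gen hf a
  | succ k ih =>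
    rw [Sh.adIter_succ_apply]
    exact sub_mem (del_mem_coordRing gen (ih hf) b) (ih (del_mem_coordRing gen hf b))

lemma scale_mem_coordRing (t : ℚ) (φ : 𝔤 →ₗ⁅ℚ⁆ 𝔤) (hφ : ∀ a, φ (gen a) = t • gen a)
    {f : Sh X} (hf : f ∈ coordRing gen) : Sh.scale t f ∈ coordRing gen := by
  obtain ⟨F, hF⟩ := hf
  have key : ∀ w, UniversalEnvelopingAlgebra.lift ℚ ((UniversalEnvelopingAlgebra.ι ℚ).comp φ)
      (envWord gen w) = t ^ w.length • envWord gen w := by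
    intro w
    induction w with
    | nil => simp [envWord_nil]
    | cons a w ih =>
      rw [envWord_cons, map_mul, ih, UniversalEnvelopingAlgebra.lift_ι_apply, LieHom.comp_apply, hφ,
        List.length_cons, pow_succ']
      simp only [map_smul, smul_mul_smul_comm]
  refine ⟨F ∘ₗ (UniversalEnvelopingAlgebra.lift ℚ
    ((UniversalEnvelopingAlgebra.ι ℚ).comp φ)).toLinearMap, fun w => ?_⟩
  rw [Sh.coeff_scale, hF, LinearMap.comp_apply, AlgHom.toLinearMap_apply, key, map_smul,
    smul_eq_mul]

/-- The operator `x` on the coordinate ring is given by the action of the Lie algebra element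
`Y`. -/
def Represents (x : Sh X → Sh X) (Y : 𝔤) : Prop :=
  ∀ (f : Sh X) (F : UniversalEnvelopingAlgebra ℚ 𝔤 →ₗ[ℚ] ℚ),
    (∀ w, Sh.coeff w f = F (envWord gen w)) →
    ∀ w, Sh.coeff w (x f) = F (UniversalEnvelopingAlgebra.ι ℚ Y * envWord gen w)

lemma represents_del (a : X) : Represents gen (Sh.del a) (gen a) := by
  intro f F hF w
  rw [Sh.coeff_del, hF, envWord_cons]

-- Duality reverses products: evaluating at `w`, the two terms are F(Y b w) and F(b Y w). This is
-- why the commutator of `Sh.del b` with `x` corresponds to [Y, b] and not to [b, Y].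
variable {gen} in
lemma Represents.lie {x : Sh X → Sh X} {Y : 𝔤} (h : Represents gen x Y) (b : X) :
    Represents gen (fun f => Sh.del b (x f) - x (Sh.del b f)) ⁅Y, gen b⁆ := by
  intro f F hF w
  rw [map_sub, Sh.coeff_del, h f F hF,
    h (Sh.del b f) (F ∘ₗ LinearMap.mulLeft ℚ (UniversalEnvelopingAlgebra.ι ℚ (gen b)))
      (fun u => by rw [Sh.coeff_del, hF, envWord_cons]; rfl),
    LinearMap.comp_apply, LinearMap.mulLeft_apply, ← map_sub, LieHom.map_lie,
    LieRing.of_associative_ring_bracket, envWord_cons]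
  congr 1
  noncomm_ring

/-- The iterated bracket `[⋯[[gen a, gen b], gen b], ⋯, gen b]`. -/
def lieIter (b a : X) : ℕ → 𝔤
  | 0 => gen a
  | k + 1 => ⁅lieIter b a k, gen b⁆

lemma represents_adIter (b a : X) (k : ℕ) :
    Represents gen (Sh.adIter b a k) (lieIter gen b a k) := by
  induction k with
  | zero => exact represents_del gen a
  | succ k ih => exact (funext (Sh.adIter_succ_apply b a k)) ▸ ih.lie b

end CoordRingOperations

/-! ### Iterated brackets in L^PL. -/

section LieRelations

lemma lMk_relator {x : FreeLieAlgebra ℚ PLGen} (hx : x ∈ plRelators) :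
    (LieSubmodule.Quotient.mk x : LieL) = 0 :=
  (Submodule.Quotient.mk_eq_zero _).2 (LieSubmodule.subset_lieSpan hx)

/-- The projection from the free Lie algebra to `L^PL`. -/
def plMk : FreeLieAlgebra ℚ PLGen →ₗ⁅ℚ⁆ LiePL where
  toFun x := LieSubmodule.Quotient.mk (LieSubmodule.Quotient.mk x : LieL)
  map_add' _ _ := rfl
  map_smul' _ _ := rfl
  map_lie' := rfl

lemma plMk_relator {x : FreeLieAlgebra ℚ PLGen} (hx : x ∈ plRelators) : plMk x = 0 := by
  change LieSubmodule.Quotient.mk (LieSubmodule.Quotient.mk x : LieL) = (0 : LiePL)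
  rw [lMk_relator hx]
  rfl

/-- Membership in the image of `N` in `L^PL`. -/
def MemN (x : LiePL) : Prop := ∃ y ∈ idealN, (LieSubmodule.Quotient.mk y : LiePL) = x

lemma memN_e11 : MemN (plGen .e11) := ⟨_, LieSubmodule.subset_lieSpan (by simp), rfl⟩
lemma memN_e22 : MemN (plGen .e22) := ⟨_, LieSubmodule.subset_lieSpan (by simp), rfl⟩
lemma memN_e12 : MemN (plGen .e12) := ⟨_, LieSubmodule.subset_lieSpan (by simp), rfl⟩

lemma MemN.lie {x : LiePL} (hx : MemN x) (b : PLGen) : MemN ⁅x, plGen b⁆ := by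
  obtain ⟨y, hy, rfl⟩ := hx
  exact ⟨⁅y, lGen b⁆, lie_mem_left ℚ LieL idealN y (lGen b) hy, rfl⟩

lemma MemN.lie_eq_zero {x y : LiePL} (hx : MemN x) (hy : MemN y) : ⁅x, y⁆ = 0 := by
  obtain ⟨u, hu, rfl⟩ := hx
  obtain ⟨v, hv, rfl⟩ := hy
  exact (Submodule.Quotient.mk_eq_zero _).2 (LieSubmodule.lie_mem_lie hu hv)

lemma MemN.lieIter {a : PLGen} (h : MemN (plGen a)) (b : PLGen) (k : ℕ) :
    MemN (lieIter plGen b a k) := by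
  induction k with
  | zero => exact h
  | succ k ih => exact ih.lie b

lemma plGen_e1_e2 : ⁅plGen .e1, plGen .e2⁆ = 0 :=
  plMk_relator (x := ⁅freeGen .e1, freeGen .e2⁆) (by simp [plRelators])

lemma plGen_e11_e2 : ⁅plGen .e11, plGen .e2⁆ = 0 :=
  plMk_relator (x := ⁅freeGen .e11, freeGen .e2⁆) (by simp [plRelators])

lemma plGen_e1_e22 : ⁅plGen .e1, plGen .e22⁆ = 0 :=
  plMk_relator (x := ⁅freeGen .e1, freeGen .e22⁆) (by simp [plRelators])

/-- In the last relator the bracket [e₁₁,e₂₂] lies in [N,N] and dies, leaving [e₂ - e₁, e₁₂] = 0. -/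
lemma plGen_e12_e2 : ⁅plGen .e12, plGen .e2⁆ = ⁅plGen .e12, plGen .e1⁆ := by
  have h : ⁅plGen .e11, plGen .e22⁆ - ⁅plGen .e2 - plGen .e1, plGen .e12⁆ = 0 :=
    plMk_relator (x := ⁅freeGen .e11, freeGen .e22⁆ - ⁅freeGen .e2 - freeGen .e1, freeGen .e12⁆)
      (by simp [plRelators])
  rw [memN_e11.lie_eq_zero memN_e22, zero_sub, neg_eq_zero, sub_lie, sub_eq_zero] at h
  rw [← lie_skew, h, lie_skew]

lemma lie_lie_comm_of_lie_eq_zero {L : Type*} [LieRing L] {x y z : L} (h : ⁅y, z⁆ = 0) :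
    ⁅⁅x, y⁆, z⁆ = ⁅⁅x, z⁆, y⁆ := by
  rw [lie_lie, h, lie_zero, zero_sub, lie_skew]

lemma lieIter_e11_e2 (k : ℕ) : ⁅lieIter plGen .e1 .e11 k, plGen .e2⁆ = 0 := by
  induction k with
  | zero => exact plGen_e11_e2
  | succ k ih => rw [lieIter, lie_lie_comm_of_lie_eq_zero plGen_e1_e2, ih, zero_lie]

lemma lieIter_e22_e1 (k : ℕ) : ⁅lieIter plGen .e2 .e22 k, plGen .e1⁆ = 0 := by
  have h : ⁅plGen .e2, plGen .e1⁆ = 0 := by rw [← lie_skew, plGen_e1_e2, neg_zero]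
  induction k with
  | zero => rw [lieIter, ← lie_skew, plGen_e1_e22, neg_zero]
  | succ k ih => rw [lieIter, lie_lie_comm_of_lie_eq_zero h, ih, zero_lie]

/-- By the Jacobi identity and [e₁,e₂] = 0, a bracket with e₂ moves inwards to e₁₂, where it equals
one with e₁. Hence brackets with e₁ alone suffice for the family of e₁₂. -/
lemma lieIter_e12_e2 (k : ℕ) :
    ⁅lieIter plGen .e1 .e12 k, plGen .e2⁆ = lieIter plGen .e1 .e12 (k + 1) := by
  induction k with
  | zero => exact plGen_e12_e2
  | succ k ih => rw [lieIter, lie_lie_comm_of_lie_eq_zero plGen_e1_e2, ih]; rfl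

namespace Lam

/-- The derivation of the shuffle algebra dual to `f_λ`. -/
def der : Lam → Derivation ℚ (Sh PLGen) (Sh PLGen)
  | e1 => Sh.delDer .e1
  | e2 => Sh.delDer .e2
  | l11 k => Sh.adIter .e1 .e11 k
  | l22 k => Sh.adIter .e2 .e22 k
  | l12 k => Sh.adIter .e1 .e12 k

/-- The element of `L^PL` dual to `f_λ`. -/
def lieElt : Lam → LiePL
  | e1 => plGen .e1
  | e2 => plGen .e2
  | l11 k => lieIter plGen .e1 .e11 k
  | l22 k => lieIter plGen .e2 .e22 k
  | l12 k => lieIter plGen .e1 .e12 k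

lemma represents (l : Lam) : Represents plGen l.der l.lieElt := by
  cases l with
  | e1 => exact represents_del _ _
  | e2 => exact represents_del _ _
  | l11 k => exact represents_adIter _ _ _ _
  | l22 k => exact represents_adIter _ _ _ _
  | l12 k => exact represents_adIter _ _ _ _

lemma der_mem (l : Lam) {f : Sh PLGen} (hf : f ∈ APL) : l.der f ∈ APL := by
  cases l with
  | e1 => exact del_mem_coordRing _ hf _
  | e2 => exact del_mem_coordRing _ hf _
  | l11 k => exact adIter_mem_coordRing _ hf _ _ _
  | l22 k => exact adIter_mem_coordRing _ hf _ _ _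
  | l12 k => exact adIter_mem_coordRing _ hf _ _ _

lemma der_isLen (l : Lam) {f : Sh PLGen} {n : ℤ} (hf : Sh.IsLen n f) :
    Sh.IsLen (n - l.wt) (l.der f) := by
  cases l with
  | e1 => exact hf.del _
  | e2 => exact hf.del _
  | l11 k => simpa [wt, der] using hf.adIter _ _ _
  | l22 k => simpa [wt, der] using hf.adIter _ _ _
  | l12 k => simpa [wt, der] using hf.adIter _ _ _

lemma one_le_wt (l : Lam) : 1 ≤ l.wt := by cases l <;> simp [wt]

-- The multiplication table of L^PL: brackets inside the image of N vanish, and a bracket with e₁ or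
-- e₂ either vanishes or moves one step along a family. Closure under right brackets by generators
-- is all that the Dynkin argument needs.
open Submodule in
lemma lieElt_lie_mem (l : Lam) (b : PLGen) :
    ⁅l.lieElt, plGen b⁆ ∈ span ℚ (Set.range lieElt) := by
  have mem : ∀ l : Lam, l.lieElt ∈ span ℚ (Set.range lieElt) := fun l => subset_span ⟨l, rfl⟩
  have zero : ∀ {x : LiePL}, x = 0 → x ∈ span ℚ (Set.range lieElt) := fun h => h ▸ zero_mem _
  have neg : ∀ {a c : PLGen} {l : Lam}, ⁅plGen c, plGen a⁆ = l.lieElt →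
      ⁅plGen a, plGen c⁆ ∈ span ℚ (Set.range lieElt) := fun h => by
    rw [← lie_skew, h]; exact neg_mem (mem _)
  have hN : ∀ {b}, MemN (plGen b) → ∀ a, MemN (plGen a) → ∀ c k,
      ⁅lieIter plGen c a k, plGen b⁆ ∈ span ℚ (Set.range lieElt) :=
    fun hb a ha c k => zero ((ha.lieIter c k).lie_eq_zero hb)
  cases l with
  | e1 =>
    cases b with
    | e1 => exact zero (lie_self _)
    | e2 => exact zero plGen_e1_e2
    | e11 => exact neg (l := .l11 1) rfl
    | e22 => exact zero plGen_e1_e22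
    | e12 => exact neg (l := .l12 1) rfl
  | e2 =>
    cases b with
    | e1 => exact zero (by rw [lieElt, ← lie_skew, plGen_e1_e2, neg_zero])
    | e2 => exact zero (lie_self _)
    | e11 => exact zero (by rw [lieElt, ← lie_skew, plGen_e11_e2, neg_zero])
    | e22 => exact neg (l := .l22 1) rfl
    | e12 => exact neg (l := .l12 1) plGen_e12_e2
  | l11 k =>
    cases b with
    | e1 => exact mem (.l11 (k + 1))
    | e2 => exact zero (lieIter_e11_e2 k)
    | e11 => exact hN memN_e11 _ memN_e11 _ _
    | e22 => exact hN memN_e22 _ memN_e11 _ _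
    | e12 => exact hN memN_e12 _ memN_e11 _ _
  | l22 k =>
    cases b with
    | e1 => exact zero (lieIter_e22_e1 k)
    | e2 => exact mem (.l22 (k + 1))
    | e11 => exact hN memN_e11 _ memN_e22 _ _
    | e22 => exact hN memN_e22 _ memN_e22 _ _
    | e12 => exact hN memN_e12 _ memN_e22 _ _
  | l12 k =>
    cases b with
    | e1 => exact mem (.l12 (k + 1))
    | e2 => rw [lieElt, lieIter_e12_e2]; exact mem (.l12 (k + 1))
    | e11 => exact hN memN_e11 _ memN_e12 _ _
    | e22 => exact hN memN_e22 _ memN_e12 _ _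
    | e12 => exact hN memN_e12 _ memN_e12 _ _

end Lam

lemma lie_plGen_mem_span {x : LiePL} (hx : x ∈ Submodule.span ℚ (Set.range Lam.lieElt))
    (b : PLGen) : ⁅x, plGen b⁆ ∈ Submodule.span ℚ (Set.range Lam.lieElt) := by
  induction hx using Submodule.span_induction with
  | mem x h => obtain ⟨l, rfl⟩ := h; exact l.lieElt_lie_mem b
  | zero => rw [zero_lie]; exact zero_mem _
  | add x y _ _ hx hy => rw [add_lie]; exact add_mem hx hy
  | smul t x _ hx => rw [smul_lie]; exact Submodule.smul_mem _ _ hx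

lemma plGen_mem_span (b : PLGen) : plGen b ∈ Submodule.span ℚ (Set.range Lam.lieElt) := by
  cases b with
  | e1 => exact Submodule.subset_span ⟨.e1, rfl⟩
  | e2 => exact Submodule.subset_span ⟨.e2, rfl⟩
  | e11 => exact Submodule.subset_span ⟨.l11 0, rfl⟩
  | e22 => exact Submodule.subset_span ⟨.l22 0, rfl⟩
  | e12 => exact Submodule.subset_span ⟨.l12 0, rfl⟩

end LieRelations

/-! ### The length grading of A^PL. -/

section Grading

/-- `L^PL` has an endomorphism that scales the generators by `t`. -/
lemma exists_scaleHom (t : ℚ) : ∃ φ : LiePL →ₗ⁅ℚ⁆ LiePL, ∀ a, φ (plGen a) = t • plGen a := by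
  let φ₀ : FreeLieAlgebra ℚ PLGen →ₗ⁅ℚ⁆ FreeLieAlgebra ℚ PLGen :=
    FreeLieAlgebra.lift ℚ fun a => t • freeGen a
  have hφ₀ : ∀ a, φ₀ (freeGen a) = t • freeGen a := fun a => FreeLieAlgebra.lift_of_apply _ a
  let m₁ : FreeLieAlgebra ℚ PLGen →ₗ⁅ℚ⁆ LieL :=
    { toFun := fun x => LieSubmodule.Quotient.mk x
      map_add' := fun _ _ => rfl
      map_smul' := fun _ _ => rfl
      map_lie' := rfl }
  have k₀ : LieSubmodule.lieSpan ℚ (FreeLieAlgebra ℚ PLGen) plRelators ≤ (m₁.comp φ₀).ker := by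
    rw [LieSubmodule.lieSpan_le]
    intro x hx
    have hx' := hx
    rw [SetLike.mem_coe, LieHom.mem_ker, LieHom.comp_apply]
    -- All relators are homogeneous of degree two, so the scaling multiplies them by t².
    have : φ₀ x = (t * t) • x := by
      simp only [plRelators, Set.mem_insert_iff, Set.mem_singleton_iff] at hx
      rcases hx with rfl | rfl | rfl | rfl | rfl | rfl <;>
        simp only [map_add, map_sub, LieHom.map_lie, hφ₀, sub_lie, smul_lie, lie_smul, smul_smul,
          smul_add, smul_sub]
    rw [this, map_smul, show m₁ x = 0 from lMk_relator hx', smul_zero]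
  let φ₁ : LieL →ₗ⁅ℚ⁆ LieL := quotLift _ (m₁.comp φ₀) k₀
  have hφ₁ : ∀ a, φ₁ (lGen a) = t • lGen a := fun a => by
    change m₁ (φ₀ (freeGen a)) = _
    rw [hφ₀, map_smul]; rfl
  have hN : idealN ≤ idealN.comap φ₁ := by
    rw [idealN, LieSubmodule.lieSpan_le]
    intro x hx
    rw [SetLike.mem_coe, LieIdeal.mem_comap]
    have hx' := LieSubmodule.subset_lieSpan (R := ℚ) (L := LieL) hx
    rcases hx with rfl | rfl | rfl <;> rw [hφ₁] <;> exact Submodule.smul_mem _ t hx'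
  let m₂ : LieL →ₗ⁅ℚ⁆ LiePL :=
    { toFun := fun x => LieSubmodule.Quotient.mk x
      map_add' := fun _ _ => rfl
      map_smul' := fun _ _ => rfl
      map_lie' := rfl }
  have k₁ : ⁅idealN, idealN⁆ ≤ (m₂.comp φ₁).ker := by
    refine (LieSubmodule.lie_le_iff _ _ _).2 fun x hx y hy => ?_
    rw [LieHom.mem_ker, LieHom.comp_apply]
    rw [LieHom.map_lie]
    exact (Submodule.Quotient.mk_eq_zero _).2 (LieSubmodule.lie_mem_lie (hN hx) (hN hy))
  refine ⟨quotLift _ (m₂.comp φ₁) k₁, fun a => ?_⟩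
  change m₂ (φ₁ (lGen a)) = _
  rw [hφ₁, map_smul]; rfl

lemma scale_mem_APL (t : ℚ) {f : Sh PLGen} (hf : f ∈ APL) : Sh.scale t f ∈ APL := by
  obtain ⟨φ, hφ⟩ := exists_scaleHom t
  exact scale_mem_coordRing plGen t φ hφ hf

/-- Homogeneity of the relations gives scaling endomorphisms of L^PL; so A^PL is stable under
scaling, and therefore graded. -/
lemma comp_mem_APL (n : ℕ) {f : Sh PLGen} (hf : f ∈ APL) : Sh.comp n f ∈ APL :=
  Sh.comp_mem_of_scale (Subalgebra.toSubmodule APL) f (fun t => scale_mem_APL t hf) n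

lemma isLen_comp {X : Type*} (n : ℕ) (f : Sh X) : Sh.IsLen n (Sh.comp n f) := by
  intro w hw
  rw [Sh.coeff_comp, if_neg (by exact_mod_cast hw)]

lemma mem_APL_homog {n : ℕ} {f : APL} : f ∈ APL.homog n ↔ Sh.IsLen n (f : Sh PLGen) :=
  Sh.mem_homog_one_iff n _

/-- `A^PL` is the sum of its homogeneous parts. -/
lemma APL_induction {p : APL → Prop} (h0 : p 0) (hadd : ∀ f g, p f → p g → p (f + g))
    (hom : ∀ n, ∀ f ∈ APL.homog n, p f) (f : APL) : p f := by
  obtain ⟨d, hd⟩ := Sh.exists_bound (f : Sh PLGen)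
  have : f = ∑ n ∈ Finset.range d, (⟨Sh.comp n f, comp_mem_APL n f.2⟩ : APL) := by
    apply Subtype.ext
    rw [AddSubmonoidClass.coe_finsetSum]
    exact (Sh.sum_comp _ d hd).symm
  rw [this]
  exact Finset.sum_induction _ p hadd h0 fun n _ => hom n _ (mem_APL_homog.2 (isLen_comp n _))

lemma euler_eq_smul {X : Type*} {n : ℕ} {f : Sh X} (hf : Sh.IsLen n f) :
    Sh.euler f = (n : ℚ) • f := by
  refine Sh.ext_coeff fun w => ?_
  rw [Sh.coeff_euler, map_smul, smul_eq_mul]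
  by_cases h : (w.length : ℤ) = n
  · rw [Int.natCast_inj.1 h]
  · rw [hf w h, mul_zero, mul_zero]

lemma euler_mem_APL {f : Sh PLGen} (hf : f ∈ APL) : Sh.euler f ∈ APL := by
  refine APL_induction (p := fun f => Sh.euler (f : Sh PLGen) ∈ APL) ?_ ?_ ?_ ⟨f, hf⟩
  · simp
  · intro f g hf hg
    rw [Subalgebra.coe_add, map_add]
    exact add_mem hf hg
  · intro n f hf
    rw [euler_eq_smul (mem_APL_homog.1 hf)]
    exact Subalgebra.smul_mem _ f.2 _

end Grading

/-! ### The Dynkin operator and derivations at the counit. -/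

section Dynkin

namespace Sh

variable {X : Type*}

/-- The convolution product of the antipode with a linear operator `x`. -/
def twist (x : Sh X →ₗ[ℚ] Sh X) : Sh X →ₗ[ℚ] Sh X :=
  LinearMap.mul' ℚ (Sh X) ∘ₗ TensorProduct.map anti x ∘ₗ comulLin

/-- Deletion of a final letter. -/
def delLast (b : X) : Sh X →ₗ[ℚ] Sh X := coordRing.contrR [b] ∘ₗ comulLin

lemma coeff_delLast (b : X) (w : List X) (f : Sh X) :
    coeff w (delLast b f) = coeff (w ++ [b]) f := by
  rw [delLast, LinearMap.comp_apply, coordRing.coeff_contrR, coeff₂_comulLin]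

lemma del_anti (b : X) (f : Sh X) : del b (anti f) = -anti (delLast b f) := by
  refine ext_coeff fun w => ?_
  rw [coeff_del, coeff_anti, map_neg, coeff_anti, coeff_delLast, List.length_cons,
    List.reverse_cons, pow_succ]
  ring

/-- Both sides have at u ⊗ v the coefficient of `f` at the word u b v: the letter at the cut may be
assigned to either factor. -/
lemma map_delLast_comulLin (b : X) (f : Sh X) :
    TensorProduct.map (delLast b) LinearMap.id (comulLin f) =
      TensorProduct.map LinearMap.id (del b) (comulLin f) := by
  have h1 : ∀ (u v : List X) (t : Sh X ⊗[ℚ] Sh X),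
      coeff₂ u v (TensorProduct.map (delLast b) LinearMap.id t) = coeff₂ (u ++ [b]) v t := by
    intro u v t
    induction t with
    | zero => simp
    | add x y hx hy => simp only [map_add, hx, hy]
    | tmul x y => simp [coeff₂_tmul, coeff_delLast]
  have h2 : ∀ (u v : List X) (t : Sh X ⊗[ℚ] Sh X),
      coeff₂ u v (TensorProduct.map LinearMap.id (del b) t) = coeff₂ u (b :: v) t := by
    intro u v t
    induction t with
    | zero => simp
    | add x y hx hy => simp only [map_add, hx, hy]
    | tmul x y => simp [coeff₂_tmul, coeff_del]
  refine ext_coeff₂ fun u v => ?_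
  rw [h1, h2, coeff₂_comulLin, coeff₂_comulLin, List.append_assoc, List.singleton_append]

/-- Leibniz gives two terms. The antipode turns deletion of a first letter into minus deletion of a
last one, which the coproduct transfers to the first letter of the other factor; together they form
the commutator of `del b` with `x`. -/
lemma del_twist (b : X) (x : Sh X →ₗ[ℚ] Sh X) (f : Sh X) :
    del b (twist x f) = twist (del b ∘ₗ x - x ∘ₗ del b) f := by
  have h : ∀ t : Sh X ⊗[ℚ] Sh X, del b (LinearMap.mul' ℚ (Sh X) (TensorProduct.map anti x t)) =
      LinearMap.mul' ℚ (Sh X) (TensorProduct.map anti (del b ∘ₗ x) t) -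
      LinearMap.mul' ℚ (Sh X) (TensorProduct.map anti x
        (TensorProduct.map (delLast b) LinearMap.id t)) := by
    intro t
    induction t with
    | zero => simp
    | add x y hx hy => simp only [map_add, hx, hy]; ring
    | tmul y z => simp [del_mul, del_anti]; ring
  have h' : ∀ t : Sh X ⊗[ℚ] Sh X,
      LinearMap.mul' ℚ (Sh X) (TensorProduct.map anti (del b ∘ₗ x) t) -
      LinearMap.mul' ℚ (Sh X) (TensorProduct.map anti x
        (TensorProduct.map LinearMap.id (del b) t)) =
      LinearMap.mul' ℚ (Sh X) (TensorProduct.map anti (del b ∘ₗ x - x ∘ₗ del b) t) := by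
    intro t
    induction t with
    | zero => simp
    | add x y hx hy => simp only [map_add, ← hx, ← hy]; ring
    | tmul y z => simp [mul_sub]
  rw [twist, LinearMap.comp_apply, LinearMap.comp_apply, h, map_delLast_comulLin, h']
  rfl

lemma contrL_nil_comulLin (f : Sh X) : contrL [] (comulLin f) = f :=
  ext_coeff fun w => by rw [coeff_contrL, coeff₂_comulLin, List.nil_append]

lemma coeff_nil_twist (x : Sh X →ₗ[ℚ] Sh X) (f : Sh X) :
    coeff [] (twist x f) = coeff [] (x f) := by
  have h : ∀ t : Sh X ⊗[ℚ] Sh X,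
      coeff [] (LinearMap.mul' ℚ (Sh X) (TensorProduct.map anti x t)) =
        coeff [] (x (contrL [] t)) := by
    intro t
    induction t with
    | zero => simp
    | add x y hx hy => simp only [map_add, hx, hy]
    | tmul y z => simp [coeff_nil_mul, coeff_anti, contrL_tmul]
  rw [twist, LinearMap.comp_apply, LinearMap.comp_apply, h, contrL_nil_comulLin]

/-- The coefficient of `twist x f` at a word is the constant term of an iterated commutator of `x`
with deletions, applied to `f`. A class of operators stable under these commutators thus reduces the
vanishing to the empty word. -/
lemma twist_eq_zero (P : (Sh X →ₗ[ℚ] Sh X) → Prop) (f : Sh X)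
    (hP : ∀ x b, P x → P (del b ∘ₗ x - x ∘ₗ del b)) (h0 : ∀ x, P x → coeff [] (x f) = 0)
    (x : Sh X →ₗ[ℚ] Sh X) (hx : P x) : twist x f = 0 := by
  refine ext_coeff fun w => ?_
  rw [map_zero]
  induction w generalizing x with
  | nil => rw [coeff_nil_twist, h0 x hx]
  | cons b w ih => rw [← coeff_del, del_twist]; exact ih _ (hP x b hx)

lemma del_comp_euler_sub (b : X) : del b ∘ₗ euler - euler ∘ₗ del b = del b := by
  refine LinearMap.ext fun f => ext_coeff fun w => ?_
  rw [LinearMap.sub_apply, LinearMap.comp_apply, LinearMap.comp_apply, map_sub, coeff_del,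
    coeff_euler, coeff_euler, coeff_del, List.length_cons]
  push_cast
  ring

/-- The Dynkin operator `twist euler` kills functions killed by the operators `twist (del b)`. -/
lemma twist_euler_eq_zero (f : Sh X) (h : ∀ b, twist (del b) f = 0) : twist euler f = 0 := by
  refine ext_coeff fun w => ?_
  cases w with
  | nil => rw [coeff_nil_twist, coeff_euler]; simp
  | cons b w => rw [← coeff_del, del_twist, del_comp_euler_sub, h, map_zero, map_zero]

end Sh

/-- The commutator of a deletion with the Euler operator is that deletion, so only iterated
commutators of deletions occur. They represent iterated brackets of generators, which lie in the
span of the `Lam.lieElt`, where `h0` applies. -/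
lemma twist_euler_APL {f : Sh PLGen} (hf : f ∈ APL)
    (h0 : ∀ l : Lam, Sh.coeff [] (l.der f) = 0) : Sh.twist Sh.euler f = 0 := by
  obtain ⟨F, hF⟩ := hf
  refine Sh.twist_euler_eq_zero f fun b => Sh.twist_eq_zero
    (fun x => ∃ Y ∈ Submodule.span ℚ (Set.range Lam.lieElt), Represents plGen x Y) f ?_ ?_ _
    ⟨plGen b, plGen_mem_span b, represents_del plGen b⟩
  · rintro x b ⟨Y, hY, hx⟩
    exact ⟨_, lie_plGen_mem_span hY b, hx.lie b⟩
  · rintro x ⟨Y, hY, hx⟩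
    rw [hx f F hF, envWord_nil, mul_one]
    clear hx
    induction hY using Submodule.span_induction with
    | mem Y h =>
      obtain ⟨l, rfl⟩ := h
      rw [← h0 l, l.represents f F hF, envWord_nil, mul_one]
    | zero => simp
    | add X Y _ _ hX hY => rw [map_add, map_add, hX, hY, add_zero]
    | smul t X _ hX => rw [map_smul, map_smul, hX, smul_zero]

namespace APL

/-- The antipode of `A^PL`. -/
def anti : APL →ₗ[ℚ] APL :=
  (Sh.anti ∘ₗ APL.val.toLinearMap).codRestrict (Subalgebra.toSubmodule APL)
    fun f => anti_mem_coordRing plGen f.2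

/-- The Euler operator of `A^PL`. -/
def euler : APL →ₗ[ℚ] APL :=
  (Sh.euler ∘ₗ APL.val.toLinearMap).codRestrict (Subalgebra.toSubmodule APL)
    fun f => euler_mem_APL f.2

/-- The operator `∂_λ` on `A^PL`. -/
def der (l : Lam) : APL →ₗ[ℚ] APL :=
  ((l.der : Sh PLGen →ₗ[ℚ] Sh PLGen) ∘ₗ APL.val.toLinearMap).codRestrict
    (Subalgebra.toSubmodule APL) fun f => l.der_mem f.2

lemma coe_anti (f : APL) : (anti f : Sh PLGen) = Sh.anti f := rfl
lemma coe_euler (f : APL) : (euler f : Sh PLGen) = Sh.euler f := rfl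
lemma coe_der (l : Lam) (f : APL) : (der l f : Sh PLGen) = l.der f := rfl

/-- The counit of `A^PL`. -/
def eps : APL →ₗ[ℚ] ℚ := Sh.coeff [] ∘ₗ APL.val.toLinearMap

lemma eps_apply (f : APL) : eps f = Sh.coeff [] (f : Sh PLGen) := rfl

/-- Contraction with the counit in the left factor. -/
def contr : APL ⊗[ℚ] APL →ₗ[ℚ] APL := (TensorProduct.lid ℚ APL).toLinearMap ∘ₗ eps.rTensor APL

lemma contr_comulLin (f : APL) : contr (coordRing.comulLin plGen f) = f := by
  have h : ∀ t : APL ⊗[ℚ] APL, (contr t : Sh PLGen) =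
      Sh.contrL [] (TensorProduct.map (coordRing.incl plGen) (coordRing.incl plGen) t) := by
    intro t
    induction t with
    | zero => simp
    | add x y hx hy => simp only [map_add, Subalgebra.coe_add, hx, hy]
    | tmul x y => simp [contr, eps_apply, Sh.contrL_tmul]
  apply Subtype.ext
  rw [h, coordRing.map_incl_comulLin, Sh.contrL_nil_comulLin]

variable {R : Type*} [CommRing R] [Algebra ℚ R]

/-- A derivation at the counit vanishes on Euler multiples of functions that are orthogonal to
the Lie algebra. -/
lemma derivation_euler_eq_zero (D : APL →ₗ[ℚ] R)
    (hD : ∀ f g, D (f * g) = eps f • D g + eps g • D f) (f : APL)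
    (h0 : ∀ l : Lam, eps (der l f) = 0) : D (euler f) = 0 := by
  have h1 : LinearMap.mul' ℚ APL (TensorProduct.map anti euler (coordRing.comulLin plGen f)) =
      0 := by
    have : ∀ t : APL ⊗[ℚ] APL,
        ((LinearMap.mul' ℚ APL (TensorProduct.map anti euler t) : APL) : Sh PLGen) =
        LinearMap.mul' ℚ (Sh PLGen) (TensorProduct.map Sh.anti Sh.euler
          (TensorProduct.map (coordRing.incl plGen) (coordRing.incl plGen) t)) := by
      intro t
      induction t with
      | zero => simp
      | add x y hx hy => simp only [map_add, Subalgebra.coe_add, hx, hy]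
      | tmul x y => simp [coe_anti, coe_euler]
    apply Subtype.ext
    rw [this, coordRing.map_incl_comulLin]
    exact twist_euler_APL f.2 h0
  -- Of the two Leibniz terms one vanishes because Euler multiples have no constant term; in the
  -- other the antipode preserves the counit.
  have h2 : ∀ t : APL ⊗[ℚ] APL,
      D (LinearMap.mul' ℚ APL (TensorProduct.map anti euler t)) = D (euler (contr t)) := by
    intro t
    induction t with
    | zero => simp
    | add x y hx hy => simp only [map_add, hx, hy]
    | tmul x y =>
      rw [TensorProduct.map_tmul, LinearMap.mul'_apply, hD]
      simp [eps_apply, coe_euler, coe_anti, Sh.coeff_euler, Sh.coeff_anti, contr]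
  rw [← contr_comulLin f, ← h2, h1, map_zero]

end APL

end Dynkin

/-! ### Action of the iterated commutators on powers of a sum of letters. -/

section Duality

variable {X : Type*}

open Classical in
lemma Sh.del_cons_apply (a b : X) (f : Sh X) :
    Sh.del a (Sh.cons b f) = if b = a then f else 0 := by
  refine Sh.ext_coeff fun w => ?_
  rw [Sh.coeff_del, coeff_cons_cons]
  split_ifs <;> simp

lemma Sh.IsLen.cons {n : ℤ} {f : Sh X} (h : Sh.IsLen n f) (a : X) :
    Sh.IsLen (n + 1) (Sh.cons a f) := by
  classical
  intro w hw
  cases w with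
  | nil => exact coeff_nil_cons a f
  | cons b w =>
    rw [coeff_cons_cons]
    split_ifs
    · apply h
      rw [List.length_cons] at hw
      push_cast at hw
      omega
    · rfl

lemma Sh.IsLen.sum {ι : Type*} {n : ℤ} (s : Finset ι) {f : ι → Sh X}
    (h : ∀ i ∈ s, Sh.IsLen n (f i)) : Sh.IsLen n (∑ i ∈ s, f i) := by
  intro w hw
  rw [map_sum]
  exact Finset.sum_eq_zero fun i hi => h i hi w hw

lemma Sh.IsLen.smul {n : ℤ} {f : Sh X} (h : Sh.IsLen n f) (t : ℚ) : Sh.IsLen n (t • f) := by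
  intro w hw
  rw [map_smul, h w hw, smul_zero]

/-- The function `f_x` for `x = (∑_{a ∈ S} a)ⁿ`. -/
def powFun (S : Finset X) (n : ℕ) : Sh X := fPoly ((∑ a ∈ S, FreeAlgebra.ι ℚ a) ^ n)

lemma powFun_zero (S : Finset X) : powFun S 0 = 1 := by
  rw [powFun, pow_zero, fPoly_one]; rfl

lemma powFun_succ (S : Finset X) (n : ℕ) :
    powFun S (n + 1) = ∑ a ∈ S, Sh.cons a (powFun S n) := by
  rw [powFun, pow_succ']
  simp [fPoly, powFun, LinearMap.sum_apply]

lemma isLen_powFun (S : Finset X) (n : ℕ) : Sh.IsLen n (powFun S n) := by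
  induction n with
  | zero => rw [powFun_zero]; exact Sh.isLen_word []
  | succ n ih =>
    rw [powFun_succ]
    exact Sh.IsLen.sum _ fun a _ => by push_cast; exact ih.cons a

open Classical in
lemma del_powFun_succ (S : Finset X) (n : ℕ) (a : X) :
    Sh.del a (powFun S (n + 1)) = if a ∈ S then powFun S n else 0 := by
  rw [powFun_succ, map_sum]
  simp only [Sh.del_cons_apply]
  rw [Finset.sum_ite_eq']

/-- Every term of the commutator deletes the letter `d` once, and it does not occur; deletions of
`c` only lower the exponent or give zero. -/
lemma adIter_powFun (S : Finset X) (n : ℕ) (c d : X) (k : ℕ) (hd : d ∉ S) :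
    Sh.adIter c d k (powFun S n) = 0 := by
  classical
  induction k generalizing n with
  | zero =>
    cases n with
    | zero => rw [powFun_zero]; exact Sh.del_one d
    | succ n => exact (del_powFun_succ S n d).trans (if_neg hd)
  | succ k ih =>
    rw [Sh.adIter_succ_apply, ih, map_zero, zero_sub, neg_eq_zero]
    cases n with
    | zero => rw [powFun_zero, Sh.del_one, map_zero]
    | succ n =>
      rw [del_powFun_succ]
      split_ifs
      · exact ih n
      · exact map_zero _

lemma adIter_cons_of_ne {b c d : X} (hc : b ≠ c) (hd : b ≠ d) (k : ℕ) (f : Sh X) :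
    Sh.adIter c d k (Sh.cons b f) = 0 := by
  classical
  induction k with
  | zero => exact (Sh.del_cons_apply d b f).trans (if_neg hd)
  | succ k ih =>
    rw [Sh.adIter_succ_apply, ih, Sh.del_cons_apply, if_neg hc, map_zero, map_zero, sub_zero]

/-- All words start with `b`, so a term that first deletes `c` vanishes. What survives is to delete
`b` and then `c` k times, each time lowering the exponent by one. -/
lemma adIter_cons_powFun {b c : X} (hc : b ≠ c) {S : Finset X} (hS : c ∈ S) (k n : ℕ) :
    Sh.adIter c b k (Sh.cons b (powFun S n)) = if k ≤ n then powFun S (n - k) else 0 := by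
  classical
  induction k with
  | zero =>
    rw [if_pos (Nat.zero_le n), Nat.sub_zero]
    exact (Sh.del_cons_apply b b _).trans (if_pos rfl)
  | succ k ih =>
    rw [Sh.adIter_succ_apply, ih, Sh.del_cons_apply, if_neg hc, map_zero, sub_zero]
    rcases lt_trichotomy k n with h | h | h
    · rw [if_pos h.le, if_pos (Nat.succ_le_of_lt h), show n - k = n - (k + 1) + 1 by omega, del_powFun_succ, if_pos hS]
    · subst h
      rw [if_pos le_rfl, if_neg (by omega), Nat.sub_self, powFun_zero, Sh.del_one]
    · rw [if_neg (by omega), if_neg (by omega), map_zero]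

end Duality

namespace Lam

instance : DecidableEq Lam := Classical.decEq _

lemma finite_wt (m : ℕ) : {l : Lam | l.wt = m}.Finite := by
  refine Set.Finite.subset
    (Set.toFinite {e1, e2, l11 (m - 1), l22 (m - 1), l12 (m - 1)}) fun l hl => ?_
  cases l <;> simp_all [wt] <;> omega

/-- The elements of `Λ` of half-weight `m`. -/
def ofWt (m : ℕ) : Finset Lam := (finite_wt m).toFinset

lemma mem_ofWt {m : ℕ} {l : Lam} : l ∈ ofWt m ↔ l.wt = m := by simp [ofWt]

end Lam

/-! ### The three families in Λ and their duality with the operators ∂_λ. -/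

section Families

open Lam

instance : DecidableEq PLGen := Classical.decEq _

lemma coe_fLam_l11 (k : ℕ) : (fLam (l11 k) : Sh PLGen) = Sh.cons .e11 (powFun {.e1} k) := by
  simp [fLam, poly, fPoly_ι_mul, powFun]

lemma coe_fLam_l22 (k : ℕ) : (fLam (l22 k) : Sh PLGen) = Sh.cons .e22 (powFun {.e2} k) := by
  simp [fLam, poly, fPoly_ι_mul, powFun]

lemma coe_fLam_l12 (k : ℕ) : (fLam (l12 k) : Sh PLGen) = Sh.cons .e12 (powFun {.e1, .e2} k) := by
  simp [fLam, poly, fPoly_ι_mul, powFun]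

lemma coe_fLam_e1 : (fLam e1 : Sh PLGen) = powFun {.e1} 1 := by
  simp [fLam, poly, powFun]

lemma coe_fLam_e2 : (fLam e2 : Sh PLGen) = powFun {.e2} 1 := by
  simp [fLam, poly, powFun]

/-- The power is what remains of f_λ when its first letter is deleted, and deletion preserves A^PL.
-/
lemma powFun_mem_APL {b : PLGen} {S : Finset PLGen} {n : ℕ} {f : APL}
    (h : (f : Sh PLGen) = Sh.cons b (powFun S n)) : powFun S n ∈ APL := by
  have := del_mem_coordRing plGen f.2 b
  rwa [h, Sh.del_cons_apply, if_pos rfl] at this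

/-- The powers `(∑_{a ∈ S} a)ᵏ` for `S = {e₁}`. -/
def pow11 (k : ℕ) : APL := ⟨powFun {PLGen.e1} k, powFun_mem_APL (coe_fLam_l11 k)⟩
/-- The powers `(∑_{a ∈ S} a)ᵏ` for `S = {e₂}`. -/
def pow22 (k : ℕ) : APL := ⟨powFun {PLGen.e2} k, powFun_mem_APL (coe_fLam_l22 k)⟩
/-- The powers `(∑_{a ∈ S} a)ᵏ` for `S = {e₁, e₂}`. -/
def pow12 (k : ℕ) : APL := ⟨powFun {PLGen.e1, PLGen.e2} k, powFun_mem_APL (coe_fLam_l12 k)⟩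

/-- A family `λ_k = e_b (∑_{a ∈ S} a)ᵏ` in `Λ`, together with the functions `(∑_{a ∈ S} a)ᵏ` and
the actions of the operators `∂_μ` on them. -/
structure LamFamily (lam : ℕ → Lam) (y : APL) where
  /-- The functions attached to the powers of `∑_{a ∈ S} a`. -/
  pow : ℕ → APL
  /-- The coefficient of `e₁`. -/
  s1 : ℚ
  /-- The coefficient of `e₂`. -/
  s2 : ℚ
  pow_zero : pow 0 = 1
  y_eq : y = s1 • fLam e1 + s2 • fLam e2
  wt_lam : ∀ k, (lam k).wt = k + 1
  der_lam : ∀ j k, APL.der (lam j) (fLam (lam k)) = if j ≤ k then pow (k - j) else 0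
  der_lam_of_ne : ∀ μ k, (∀ j, μ ≠ lam j) → APL.der μ (fLam (lam k)) = 0
  der_e1_pow : ∀ k, APL.der e1 (pow (k + 1)) = s1 • pow k
  der_e2_pow : ∀ k, APL.der e2 (pow (k + 1)) = s2 • pow k
  der_pow : ∀ μ k, μ ≠ e1 → μ ≠ e2 → APL.der μ (pow k) = 0
  eps_pow_succ : ∀ k, APL.eps (pow (k + 1)) = 0

lemma coeff_nil_powFun_succ {X : Type*} (S : Finset X) (k : ℕ) :
    Sh.coeff [] (powFun S (k + 1)) = 0 :=
  isLen_powFun S (k + 1) [] (by simp; omega)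

/-- The family `e₁₁ e₁ᵏ`. -/
def family11 : LamFamily l11 (fLam e1) where
  pow := pow11
  s1 := 1
  s2 := 0
  pow_zero := Subtype.ext (powFun_zero _)
  y_eq := by simp
  wt_lam _ := rfl
  der_lam j k := by
    apply Subtype.ext
    rw [APL.coe_der, coe_fLam_l11, Lam.der, adIter_cons_powFun (by simp) (by simp)]
    split_ifs <;> rfl
  der_lam_of_ne μ k h := by
    apply Subtype.ext
    rw [APL.coe_der, coe_fLam_l11]
    cases μ with
    | l11 j => exact absurd rfl (h j)
    | e1 => exact (Sh.del_cons_apply _ _ _).trans (if_neg (by simp))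
    | e2 => exact (Sh.del_cons_apply _ _ _).trans (if_neg (by simp))
    | l22 j => exact adIter_cons_of_ne (by simp) (by simp) _ _
    | l12 j => exact adIter_cons_of_ne (by simp) (by simp) _ _
  der_e1_pow k := Subtype.ext ((del_powFun_succ _ _ _).trans (by simp [pow11]))
  der_e2_pow k := Subtype.ext ((del_powFun_succ _ _ _).trans (by simp [pow11]))
  der_pow μ k h1 h2 := by
    apply Subtype.ext
    cases μ <;> first | exact absurd rfl h1 | exact absurd rfl h2 |
      exact adIter_powFun _ _ _ _ _ (by simp)
  eps_pow_succ k := coeff_nil_powFun_succ _ k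

/-- The family `e₂₂ e₂ᵏ`. -/
def family22 : LamFamily l22 (fLam e2) where
  pow := pow22
  s1 := 0
  s2 := 1
  pow_zero := Subtype.ext (powFun_zero _)
  y_eq := by simp
  wt_lam _ := rfl
  der_lam j k := by
    apply Subtype.ext
    rw [APL.coe_der, coe_fLam_l22, Lam.der, adIter_cons_powFun (by simp) (by simp)]
    split_ifs <;> rfl
  der_lam_of_ne μ k h := by
    apply Subtype.ext
    rw [APL.coe_der, coe_fLam_l22]
    cases μ with
    | l22 j => exact absurd rfl (h j)
    | e1 => exact (Sh.del_cons_apply _ _ _).trans (if_neg (by simp))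
    | e2 => exact (Sh.del_cons_apply _ _ _).trans (if_neg (by simp))
    | l11 j => exact adIter_cons_of_ne (by simp) (by simp) _ _
    | l12 j => exact adIter_cons_of_ne (by simp) (by simp) _ _
  der_e1_pow k := Subtype.ext ((del_powFun_succ _ _ _).trans (by simp [pow22]))
  der_e2_pow k := Subtype.ext ((del_powFun_succ _ _ _).trans (by simp [pow22]))
  der_pow μ k h1 h2 := by
    apply Subtype.ext
    cases μ <;> first | exact absurd rfl h1 | exact absurd rfl h2 |
      exact adIter_powFun _ _ _ _ _ (by simp)
  eps_pow_succ k := coeff_nil_powFun_succ _ k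

/-- The family `e₁₂ (e₁ + e₂)ᵏ`. -/
def family12 : LamFamily l12 (fLam e1 + fLam e2) where
  pow := pow12
  s1 := 1
  s2 := 1
  pow_zero := Subtype.ext (powFun_zero _)
  y_eq := by simp
  wt_lam _ := rfl
  der_lam j k := by
    apply Subtype.ext
    rw [APL.coe_der, coe_fLam_l12, Lam.der, adIter_cons_powFun (by simp) (by simp)]
    split_ifs <;> rfl
  der_lam_of_ne μ k h := by
    apply Subtype.ext
    rw [APL.coe_der, coe_fLam_l12]
    cases μ with
    | l12 j => exact absurd rfl (h j)
    | e1 => exact (Sh.del_cons_apply _ _ _).trans (if_neg (by simp))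
    | e2 => exact (Sh.del_cons_apply _ _ _).trans (if_neg (by simp))
    | l11 j => exact adIter_cons_of_ne (by simp) (by simp) _ _
    | l22 j => exact adIter_cons_of_ne (by simp) (by simp) _ _
  der_e1_pow k := Subtype.ext ((del_powFun_succ _ _ _).trans (by simp [pow12]))
  der_e2_pow k := Subtype.ext ((del_powFun_succ _ _ _).trans (by simp [pow12]))
  der_pow μ k h1 h2 := by
    apply Subtype.ext
    cases μ <;> first | exact absurd rfl h1 | exact absurd rfl h2 |
      exact adIter_powFun _ _ _ _ _ (by simp)
  eps_pow_succ k := coeff_nil_powFun_succ _ k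

lemma APL.eps_one : APL.eps 1 = 1 := Sh.coeff_nil_one

lemma family11_pow_one : family11.pow 1 = fLam e1 := Subtype.ext coe_fLam_e1.symm
lemma family22_pow_one : family22.pow 1 = fLam e2 := Subtype.ext coe_fLam_e2.symm

lemma LamFamily.eps_der {lam : ℕ → Lam} {y : APL} (F : LamFamily lam y) (μ : Lam) (k : ℕ) :
    APL.eps (APL.der μ (fLam (lam k))) = if μ = lam k then 1 else 0 := by
  by_cases h : ∃ j, μ = lam j
  · obtain ⟨j, rfl⟩ := h
    have inj : lam j = lam k ↔ j = k := by
      constructor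
      · intro h
        have := congrArg Lam.wt h
        rw [F.wt_lam, F.wt_lam] at this
        omega
      · rintro rfl; rfl
    rw [F.der_lam]
    simp only [inj]
    rcases lt_trichotomy j k with h | h | h
    · rw [if_pos h.le, if_neg h.ne, show k - j = k - j - 1 + 1 by omega, F.eps_pow_succ]
    · subst h
      rw [if_pos le_rfl, if_pos rfl, Nat.sub_self, F.pow_zero, APL.eps_one]
    · rw [if_neg (by omega), if_neg h.ne', map_zero]
  · push Not at h
    rw [F.der_lam_of_ne μ k h, map_zero, if_neg (h k)]

/-- The functions `f_λ` are dual to the operators `∂_μ`. -/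
lemma eps_der_fLam (μ l : Lam) : APL.eps (APL.der μ (fLam l)) = if μ = l then 1 else 0 := by
  cases l with
  | l11 k => exact family11.eps_der μ k
  | l22 k => exact family22.eps_der μ k
  | l12 k => exact family12.eps_der μ k
  | e1 =>
    rw [← family11_pow_one]
    by_cases h1 : μ = e1
    · subst h1
      rw [family11.der_e1_pow 0, family11.pow_zero, map_smul, APL.eps_one]
      simp [family11]
    by_cases h2 : μ = e2
    · subst h2
      rw [family11.der_e2_pow 0]
      simp [family11]
    · rw [family11.der_pow μ 1 h1 h2, map_zero, if_neg h1]
  | e2 =>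
    rw [← family22_pow_one]
    by_cases h1 : μ = e1
    · subst h1
      rw [family22.der_e1_pow 0]
      simp [family22]
    by_cases h2 : μ = e2
    · subst h2
      rw [family22.der_e2_pow 0, family22.pow_zero, map_smul, APL.eps_one]
      simp [family22]
    · rw [family22.der_pow μ 1 h1 h2, map_zero, if_neg h2]

lemma isLen_fLam (l : Lam) : Sh.IsLen l.wt (fLam l : Sh PLGen) := by
  cases l with
  | e1 => rw [coe_fLam_e1]; exact isLen_powFun _ 1
  | e2 => rw [coe_fLam_e2]; exact isLen_powFun _ 1
  | l11 k => rw [coe_fLam_l11]; exact (isLen_powFun _ k).cons _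
  | l22 k => rw [coe_fLam_l22]; exact (isLen_powFun _ k).cons _
  | l12 k => rw [coe_fLam_l12]; exact (isLen_powFun _ k).cons _

lemma eps_der_eq_zero {n : ℕ} {f : APL} (hf : f ∈ APL.homog n) {l : Lam} (hl : l.wt ≠ n) :
    APL.eps (APL.der l f) = 0 :=
  l.der_isLen (mem_APL_homog.1 hf) [] (by simp only [List.length_nil]; omega)

variable {R : Type*} [CommRing R] [Algebra ℚ R]

/-- A homogeneous derivation at the counit is determined by its values on the functions `f_λ`. -/
lemma APL.derivation_eq_sum (D : APL →ₗ[ℚ] R)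
    (hD : ∀ f g, D (f * g) = APL.eps f • D g + APL.eps g • D f) {m : ℕ} (hm : 1 ≤ m)
    (hdeg : ∀ n, n ≠ m → ∀ f ∈ APL.homog n, D f = 0) (f : APL) :
    D f = ∑ l ∈ Lam.ofWt m, APL.eps (APL.der l f) • D (fLam l) := by
  induction f using APL_induction with
  | h0 => simp
  | hadd f g hf hg => simp only [map_add, hf, hg, add_smul, Finset.sum_add_distrib]
  | hom n f hf =>
    by_cases hn : n = m
    · subst hn
      -- By duality, subtracting this combination makes ε(∂_μ h) = 0 for all μ of weight n; for
      -- other weights this holds for degree reasons.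
      set h : APL := f - ∑ l ∈ Lam.ofWt n, APL.eps (APL.der l f) • fLam l with hh
      have h1 : ∀ μ, APL.eps (APL.der μ h) = 0 := by
        intro μ
        rw [hh, map_sub, map_sub, map_sum, map_sum]
        simp only [map_smul, eps_der_fLam, smul_eq_mul, mul_ite, mul_one, mul_zero,
          Finset.sum_ite_eq]
        split_ifs with hμ
        · rw [sub_self]
        · rw [eps_der_eq_zero hf (fun h => hμ (Lam.mem_ofWt.2 h)), sub_zero]
      have h2 : APL.euler h = (n : ℚ) • h := by
        apply Subtype.ext
        refine euler_eq_smul (Sh.IsLen.sub (mem_APL_homog.1 hf) ?_)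
        change Sh.IsLen n (APL.val.toLinearMap _)
        rw [map_sum]
        refine Sh.IsLen.sum _ fun l hl => ?_
        rw [map_smul, ← Lam.mem_ofWt.1 hl]
        exact (isLen_fLam l).smul _
      have h3 := APL.derivation_euler_eq_zero D hD h h1
      -- The Dynkin argument gives n D(h) = 0, and n ≥ 1 can be cancelled over ℚ.
      rw [h2, map_smul, smul_eq_zero_iff_right (by positivity), hh, map_sub, sub_eq_zero,
        map_sum] at h3
      rw [h3]
      simp only [map_smul]
    · rw [hdeg n hn f hf]
      refine (Finset.sum_eq_zero fun l hl => ?_).symm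
      rw [eps_der_eq_zero hf (by rw [Lam.mem_ofWt.1 hl]; exact Ne.symm hn), zero_smul]

end Families

/-! ### Compatibility of the operators ∂_λ with the coproduct. -/

section Contraction

lemma rTensor_adIter_comulLin {X : Type*} (b a : X) (k : ℕ) (f : Sh X) :
    (Sh.adIter b a k : Sh X →ₗ[ℚ] Sh X).rTensor (Sh X) (Sh.comulLin f) =
      Sh.comulLin (Sh.adIter b a k f) := by
  induction k generalizing f with
  | zero => exact Sh.delL_comulLin a f
  | succ k ih =>
    have h : ∀ t : Sh X ⊗[ℚ] Sh X,
        (Sh.adIter b a (k + 1) : Sh X →ₗ[ℚ] Sh X).rTensor (Sh X) t =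
        Sh.delL b ((Sh.adIter b a k : Sh X →ₗ[ℚ] Sh X).rTensor (Sh X) t) -
          (Sh.adIter b a k : Sh X →ₗ[ℚ] Sh X).rTensor (Sh X) (Sh.delL b t) := by
      intro t
      induction t with
      | zero => simp
      | add x y hx hy => simp only [map_add, hx, hy]; abel
      | tmul x y => simp [Sh.delL, Sh.adIter_succ_apply, TensorProduct.sub_tmul]
    rw [h, ih, Sh.delL_comulLin, Sh.delL_comulLin, ih, Sh.adIter_succ_apply, map_sub]

lemma Lam.rTensor_der_comulLin (l : Lam) (f : Sh PLGen) :
    (l.der : Sh PLGen →ₗ[ℚ] Sh PLGen).rTensor (Sh PLGen) (Sh.comulLin f) =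
      Sh.comulLin (l.der f) := by
  cases l with
  | e1 => exact Sh.delL_comulLin _ f
  | e2 => exact Sh.delL_comulLin _ f
  | l11 k => exact rTensor_adIter_comulLin _ _ _ f
  | l22 k => exact rTensor_adIter_comulLin _ _ _ f
  | l12 k => exact rTensor_adIter_comulLin _ _ _ f

/-- ∂_λ removes letters at the front, so it commutes with the coproduct when acting on the left
factor; the counit axiom does the rest. This evaluates the left-hand factor in the recursion for
words. -/
lemma APL.contr_der_comulLin (l : Lam) (f : APL) :
    APL.contr ((APL.der l).rTensor APL (coordRing.comulLin plGen f)) = APL.der l f := by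
  have h : ∀ t : APL ⊗[ℚ] APL, (APL.contr ((APL.der l).rTensor APL t) : Sh PLGen) =
      Sh.contrL [] ((l.der : Sh PLGen →ₗ[ℚ] Sh PLGen).rTensor (Sh PLGen)
        (TensorProduct.map (coordRing.incl plGen) (coordRing.incl plGen) t)) := by
    intro t
    induction t with
    | zero => simp
    | add x y hx hy => simp only [map_add, Subalgebra.coe_add, hx, hy]
    | tmul x y => simp [APL.contr, APL.eps_apply, Sh.contrL_tmul, APL.coe_der]
  apply Subtype.ext
  rw [h, coordRing.map_incl_comulLin, Lam.rTensor_der_comulLin, Sh.contrL_nil_comulLin, APL.coe_der]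

end Contraction

/-! ### Coefficients of words after extension of scalars. -/

section Pairing

variable {R : Type*} [CommRing R] [Algebra ℚ R] {X : Type*}

lemma pairing_tmul (w : List X) (r : R) (f : Sh X) :
    pairing w (r ⊗ₜ[ℚ] f) = Sh.coeff w f • r := by
  simp [pairing]

lemma pairing_eq_repr (w : List X) (x : R ⊗[ℚ] Sh X) :
    pairing w x = (Algebra.TensorProduct.basis R (Sh.basis (X := X))).repr x w := by
  induction x with
  | zero => simp
  | add x y hx hy => simp [hx, hy]
  | tmul r f =>
    rw [pairing_tmul, Algebra.TensorProduct.basis_repr_tmul, Finsupp.smul_apply,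
      Finsupp.mapRange_apply, ← Sh.coeff_eq_repr, smul_eq_mul, mul_comm, Algebra.smul_def]

lemma ext_pairing {x y : R ⊗[ℚ] Sh X} (h : ∀ w, pairing w x = pairing w y) : x = y := by
  apply (Algebra.TensorProduct.basis R (Sh.basis (X := X))).repr.injective
  ext w
  rw [← pairing_eq_repr, ← pairing_eq_repr, h]

lemma pairing_delR (a : X) (w : List X) (x : R ⊗[ℚ] Sh X) :
    pairing w ((Sh.del a).baseChange R x) = pairing (a :: w) x := by
  induction x with
  | zero => simp
  | add x y hx hy => simp only [map_add, hx, hy]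
  | tmul r f => rw [LinearMap.baseChange_tmul, pairing_tmul, pairing_tmul, Sh.coeff_del]

/-- The base change of a derivation satisfies the Leibniz rule. -/
lemma baseChange_derivation_mul {A : Type*} [CommRing A] [Algebra ℚ A] (D : Derivation ℚ A A)
    (x y : R ⊗[ℚ] A) : (D : A →ₗ[ℚ] A).baseChange R (x * y) =
      (D : A →ₗ[ℚ] A).baseChange R x * y + x * (D : A →ₗ[ℚ] A).baseChange R y := by
  induction x with
  | zero => simp
  | add x z hx hz => simp only [add_mul, map_add, hx, hz]; ring
  | tmul r f =>
    induction y with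
    | zero => simp
    | add y z hy hz => simp only [mul_add, map_add, hy, hz]; ring
    | tmul s g =>
      simp [← TensorProduct.tmul_add, add_comm, mul_comm]

lemma pairing_nil_mul (x y : R ⊗[ℚ] Sh X) :
    pairing [] (x * y) = pairing [] x * pairing [] y := by
  induction x with
  | zero => simp
  | add x z hx hz => simp only [add_mul, map_add, hx, hz]
  | tmul r f =>
    induction y with
    | zero => simp
    | add y z hy hz => simp only [mul_add, map_add, hy, hz]
    | tmul s g =>
      rw [Algebra.TensorProduct.tmul_mul_tmul, pairing_tmul, pairing_tmul, pairing_tmul,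
        Sh.coeff_nil_mul, smul_mul_smul_comm]

lemma pairing_cons_mul (a : X) (w : List X) (x y : R ⊗[ℚ] Sh X) :
    pairing (a :: w) (x * y) = pairing w ((Sh.del a).baseChange R x * y) +
      pairing w (x * (Sh.del a).baseChange R y) := by
  rw [← pairing_delR, ← map_add]
  exact congrArg _ (baseChange_derivation_mul (Sh.delDer a) x y)

lemma pairing_singleton_mul (a : X) (x y : R ⊗[ℚ] Sh X) :
    pairing [a] (x * y) = pairing [a] x * pairing [] y + pairing [] x * pairing [a] y := by
  rw [pairing_cons_mul, pairing_nil_mul, pairing_nil_mul, pairing_delR, pairing_delR]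

lemma pairing_eq_zero_of_mem_homog {ω : X → ℕ} {n : ℕ} {x : R ⊗[ℚ] Sh X}
    (hx : x ∈ (Sh.homog ω n).baseChange R) {w : List X} (hw : wordWt ω w ≠ n) :
    pairing w x = 0 := by
  rw [Submodule.baseChange_eq_span] at hx
  induction hx using Submodule.span_induction with
  | mem y hy =>
    obtain ⟨f, hf, rfl⟩ := hy
    rw [TensorProduct.mk_apply, pairing_tmul, (Sh.mem_homog_iff ω n f).1 hf w hw, zero_smul]
  | zero => exact map_zero _
  | add y z _ _ hy hz => rw [map_add, hy, hz, add_zero]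
  | smul r y _ hy => rw [map_smul, hy, smul_zero]

/-- The coefficient of `f_u ⊗ f_v`. -/
def pairing₂ (u v : List X) : (R ⊗[ℚ] Sh X) ⊗[R] (R ⊗[ℚ] Sh X) →ₗ[R] R :=
  LinearMap.mul' R R ∘ₗ TensorProduct.map (pairing u) (pairing v)

lemma pairing₂_tmul (u v : List X) (x y : R ⊗[ℚ] Sh X) :
    pairing₂ u v (x ⊗ₜ[R] y) = pairing u x * pairing v y := rfl

lemma ext_pairing₂ {s t : (R ⊗[ℚ] Sh X) ⊗[R] (R ⊗[ℚ] Sh X)}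
    (h : ∀ u v, pairing₂ u v s = pairing₂ u v t) : s = t := by
  apply ((Algebra.TensorProduct.basis R (Sh.basis (X := X))).tensorProduct
    (Algebra.TensorProduct.basis R (Sh.basis (X := X)))).repr.injective
  ext ⟨u, v⟩
  have key : ∀ s : (R ⊗[ℚ] Sh X) ⊗[R] (R ⊗[ℚ] Sh X),
      ((Algebra.TensorProduct.basis R (Sh.basis (X := X))).tensorProduct
        (Algebra.TensorProduct.basis R (Sh.basis (X := X)))).repr s (u, v) = pairing₂ u v s := by
    intro s
    induction s with
    | zero => simp
    | add x y hx hy => simp [hx, hy]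
    | tmul x y =>
      rw [pairing₂_tmul, pairing_eq_repr, pairing_eq_repr,
        Module.Basis.tensorProduct_repr_tmul_apply, smul_eq_mul, mul_comm]
  rw [key, key, h]

variable (R) in
/-- The map `f ⊗ g ↦ (1 ⊗ f) ⊗ (1 ⊗ g)`. -/
def baseChange₂ (A : Type*) [CommRing A] [Algebra ℚ A] :
    A ⊗[ℚ] A →ₗ[ℚ] (R ⊗[ℚ] A) ⊗[R] (R ⊗[ℚ] A) :=
  TensorProduct.lift (((TensorProduct.mk R (R ⊗[ℚ] A) (R ⊗[ℚ] A)).restrictScalars₁₂ ℚ ℚ).compl₁₂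
    (TensorProduct.mk ℚ R A 1) (TensorProduct.mk ℚ R A 1))

lemma baseChange₂_tmul {A : Type*} [CommRing A] [Algebra ℚ A] (f g : A) :
    baseChange₂ R A (f ⊗ₜ g) = (1 ⊗ₜ f) ⊗ₜ[R] (1 ⊗ₜ g) := rfl

set_option synthInstance.maxHeartbeats 200000 in
lemma comul_tmul_eq {A : Type*} [CommRing A] [Bialgebra ℚ A] (r : R) (f : A) :
    Coalgebra.comul (R := R) (r ⊗ₜ[ℚ] f) = r • baseChange₂ R A (Coalgebra.comul (R := ℚ) f) := by
  rw [TensorProduct.comul_tmul, CommSemiring.comul_apply]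
  generalize Coalgebra.comul (R := ℚ) f = t
  induction t with
  | zero => rw [TensorProduct.tmul_zero, LinearEquiv.map_zero, LinearMap.map_zero, smul_zero]
  | add x y hx hy =>
    rw [TensorProduct.tmul_add, LinearEquiv.map_add, LinearMap.map_add, smul_add, hx, hy]
  | tmul f g =>
    rw [TensorProduct.AlgebraTensorModule.tensorTensorTensorComm_tmul, baseChange₂_tmul]
    simp [← TensorProduct.tmul_smul, TensorProduct.smul_tmul']

/-- The coproduct remains deconcatenation after extension of scalars. -/
lemma pairing₂_comul (u v : List X) (x : R ⊗[ℚ] Sh X) :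
    pairing₂ u v (Coalgebra.comul (R := R) x) = pairing (u ++ v) x := by
  induction x with
  | zero => simp
  | add x y hx hy => simp only [map_add, hx, hy]
  | tmul r f =>
    have h : ∀ t : Sh X ⊗[ℚ] Sh X, pairing₂ u v (r • baseChange₂ R (Sh X) t) =
        Sh.coeff₂ u v t • r := by
      intro t
      induction t with
      | zero => simp
      | add x y hx hy => simp only [smul_add, map_add, hx, hy, add_smul]
      | tmul f g =>
        rw [baseChange₂_tmul, map_smul, pairing₂_tmul,
          pairing_tmul, pairing_tmul, Sh.coeff₂_tmul, smul_mul_smul_comm, mul_one, smul_eq_mul,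
          mul_smul_comm, mul_one]
    rw [comul_tmul_eq, h, pairing_tmul]
    exact congrArg (· • r) (Sh.coeff₂_comulLin u v f)

end Pairing

/-! ### Products of points in terms of the coproduct. -/

section PointMul

variable {R : Type*} [CommRing R] {A : Type*} [CommRing A]

/-- An arbitrary additive `L` with the right values on pure tensors may replace the product of the
two points, so the same statement serves for the identity, for tensor products of homomorphisms and
for composites of these. -/
lemma pointMul_apply [Bialgebra R A] {S : Type*} [CommRing S]
    [Algebra R S] (γ γ' : A →ₐ[R] S) (L : A ⊗[R] A → S) (h0 : L 0 = 0)
    (hadd : ∀ s t, L (s + t) = L s + L t) (hL : ∀ a b, L (a ⊗ₜ b) = γ a * γ' b) (x : A) :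
    pointMul γ γ' x = L (Coalgebra.comul (R := R) x) := by
  rw [pointMul, AlgHom.comp_apply, Bialgebra.comulAlgHom_apply]
  generalize Coalgebra.comul (R := R) x = t
  induction t with
  | zero => rw [map_zero, h0]
  | add x y hx hy => rw [map_add, hadd, hx, hy]
  | tmul a b => rw [Algebra.TensorProduct.lift_tmul, hL]

lemma includeLeft_mul_includeRight [Algebra R A] (a b : A) :
    (Algebra.TensorProduct.includeLeft (R := R) (S := R) (A := A) (B := A) a) *
      Algebra.TensorProduct.includeRight b = a ⊗ₜ b := by
  rw [Algebra.TensorProduct.includeLeft_apply, Algebra.TensorProduct.includeRight_apply,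
    Algebra.TensorProduct.tmul_mul_tmul, mul_one, one_mul]

end PointMul

/-! ### The recursion for the coefficients of a cocycle, and uniqueness. -/

namespace Cocycle

universe u v

variable {R : Type u} [CommRing R] [Algebra ℚ R] {T : Type v} {N : ℕ} (c : Cocycle R T N)

/-- The cocycle condition for the universal pair of points, the two inclusions into the tensor
square: their product is the coproduct itself. -/
lemma comul_sharp (x : R ⊗[ℚ] APL) : Coalgebra.comul (R := R) (c.sharp x) =
    Algebra.TensorProduct.map c.sharp c.sharp (Coalgebra.comul (R := R) x) := by
  have h := congrArg (· x) (c.map_pointMul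
    ((R ⊗[ℚ] Sh (Gens T N)) ⊗[R] (R ⊗[ℚ] Sh (Gens T N)))
    Algebra.TensorProduct.includeLeft Algebra.TensorProduct.includeRight)
  have hzero := map_zero (Algebra.TensorProduct.map c.sharp c.sharp)
  have hadd := map_add (Algebra.TensorProduct.map c.sharp c.sharp)
  refine Eq.trans ?_ (h.trans ?_)
  · refine (pointMul_apply _ _ (fun t => t) rfl (fun _ _ => rfl) (fun a b => ?_) (c.sharp x)).symm
    exact (includeLeft_mul_includeRight a b).symm
  · refine pointMul_apply _ _ (fun t => Algebra.TensorProduct.map c.sharp c.sharp t)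
      hzero hadd (fun a b => ?_) x
    exact (includeLeft_mul_includeRight (c.sharp a) (c.sharp b)).symm

/-- `φ^w` as a linear function on `A^PL`. -/
def phiLin (w : List (Gens T N)) : APL →ₗ[ℚ] R :=
  (pairing w).restrictScalars ℚ ∘ₗ (c.sharp.toLinearMap.restrictScalars ℚ) ∘ₗ
    (TensorProduct.mk ℚ R APL 1)

lemma phiLin_apply (w : List (Gens T N)) (f : APL) : c.phiLin w f = c.phi f w := rfl

lemma phi_append (u v : List (Gens T N)) (f : APL) : c.phi f (u ++ v) =
    LinearMap.mul' ℚ R (TensorProduct.map (c.phiLin u) (c.phiLin v)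
      (coordRing.comulLin plGen f)) := by
  have h : ∀ t : APL ⊗[ℚ] APL, pairing₂ u v (Algebra.TensorProduct.map c.sharp c.sharp
      (baseChange₂ R APL t)) =
      LinearMap.mul' ℚ R (TensorProduct.map (c.phiLin u) (c.phiLin v) t) := by
    intro t
    induction t with
    | zero => simp
    | add x y hx hy => simp only [map_add, hx, hy]
    | tmul f g =>
      rw [baseChange₂_tmul, Algebra.TensorProduct.map_tmul, pairing₂_tmul]
      rfl
  rw [phi, ← pairing₂_comul, comul_sharp, comul_tmul_eq, one_smul]
  exact h _

lemma phi_eq_zero {n : ℕ} {f : APL} (hf : f ∈ APL.homog n) {w : List (Gens T N)}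
    (hw : wordWt Gens.wt w ≠ n) : c.phi f w = 0 :=
  pairing_eq_zero_of_mem_homog (c.equivariant n f hf) hw

lemma phi_one (w : List (Gens T N)) : c.phi 1 w = pairing w 1 := by
  rw [phi, ← Algebra.TensorProduct.one_def, map_one]

lemma phi_one_nil : c.phi 1 [] = 1 := by
  rw [phi_one, Algebra.TensorProduct.one_def, pairing_tmul, Sh.coeff_nil_one, one_smul]

lemma phi_one_cons (ρ : Gens T N) (w : List (Gens T N)) : c.phi 1 (ρ :: w) = 0 := by
  rw [phi_one, Algebra.TensorProduct.one_def, pairing_tmul, ← Sh.coeff_del, Sh.del_one, map_zero,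
    zero_smul]

lemma eq_smul_one_of_mem_homog_zero {f : APL} (hf : f ∈ APL.homog 0) : f = APL.eps f • 1 := by
  apply Subtype.ext
  refine Sh.ext_coeff fun w => ?_
  change _ = Sh.coeff w (APL.eps f • (1 : Sh PLGen))
  rw [map_smul]
  cases w with
  | nil => rw [Sh.coeff_nil_one, smul_eq_mul, mul_one]; rfl
  | cons a w =>
    rw [← Sh.coeff_del a w 1, Sh.del_one, map_zero, smul_zero]
    exact mem_APL_homog.1 hf (a :: w) (by simp; omega)

/-- Equivariance alone gives compatibility with the counits: the empty word has weight zero, so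
positive degrees contribute nothing, and degree zero consists of constants. -/
lemma phi_nil (f : APL) : c.phi f [] = algebraMap ℚ R (APL.eps f) := by
  induction f using APL_induction with
  | h0 => rw [← phiLin_apply, map_zero, map_zero, map_zero]
  | hadd f g hf hg =>
    rw [← phiLin_apply, map_add, map_add, map_add, phiLin_apply, phiLin_apply, hf, hg]
  | hom n f hf =>
    rcases Nat.eq_zero_or_pos n with rfl | hn
    · rw [eq_smul_one_of_mem_homog_zero hf, ← phiLin_apply, map_smul, map_smul, phiLin_apply,
        phi_one_nil, APL.eps_one, smul_eq_mul, mul_one, Algebra.algebraMap_eq_smul_one]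
    · have h1 : wordWt (Gens.wt (T := T) (N := N)) [] ≠ n := by simp [wordWt]; omega
      have h2 : APL.eps f = 0 := mem_APL_homog.1 hf [] (by simp; omega)
      rw [c.phi_eq_zero hf h1, h2, map_zero]

lemma one_le_wt (ρ : Gens T N) : 1 ≤ ρ.wt := by
  cases ρ with
  | tau t => exact le_rfl
  | sigma m _ h _ => exact le_trans (by norm_num) h

lemma wordWt_singleton (ρ : Gens T N) : wordWt Gens.wt [ρ] = ρ.wt := by simp [wordWt]

/-- A one-letter word arises as a shuffle only from itself and the empty word, and the coefficient
at the empty word is the counit. Thus `phiLin [ρ]` is a derivation at the counit. -/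
lemma phi_singleton_mul (ρ : Gens T N) (f g : APL) : c.phiLin [ρ] (f * g) =
    APL.eps f • c.phiLin [ρ] g + APL.eps g • c.phiLin [ρ] f := by
  have h : (1 : R) ⊗ₜ[ℚ] (f * g) = (1 ⊗ₜ f) * (1 ⊗ₜ g) := by
    rw [Algebra.TensorProduct.tmul_mul_tmul, one_mul]
  have h1 := c.phi_nil f
  have h2 := c.phi_nil g
  rw [phi] at h1 h2
  rw [phiLin_apply, phi, h, map_mul, pairing_singleton_mul, h1, h2, phiLin_apply, phiLin_apply, phi,
    phi, Algebra.smul_def, Algebra.smul_def]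
  ring

/-- The value of `φ^ρ` is determined by the values on the functions `f_λ`. -/
lemma phi_singleton (ρ : Gens T N) (f : APL) : c.phi f [ρ] =
    ∑ l ∈ Lam.ofWt ρ.wt, APL.eps (APL.der l f) • c.phi (fLam l) [ρ] :=
  APL.derivation_eq_sum (c.phiLin [ρ]) (c.phi_singleton_mul ρ) (one_le_wt ρ)
    (fun n hn f hf => c.phi_eq_zero hf (by rw [wordWt_singleton]; exact hn.symm)) f

/-- The recursion that computes a cocycle from its values `φ^ρ_λ`. -/
lemma phi_cons (ρ : Gens T N) (w : List (Gens T N)) (f : APL) : c.phi f (ρ :: w) =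
    ∑ l ∈ Lam.ofWt ρ.wt, c.phi (fLam l) [ρ] * c.phi (APL.der l f) w := by
  -- Expanding the factor at `ρ` in the values on the f_λ turns it into ∂_λ followed by the counit,
  -- that is, into the contraction of the left tensor factor.
  have h : ∀ t : APL ⊗[ℚ] APL,
      LinearMap.mul' ℚ R (TensorProduct.map (c.phiLin [ρ]) (c.phiLin w) t) =
      ∑ l ∈ Lam.ofWt ρ.wt, c.phi (fLam l) [ρ] *
        c.phiLin w (APL.contr ((APL.der l).rTensor APL t)) := by
    intro t
    induction t with
    | zero => simp
    | add x y hx hy => simp only [map_add, hx, hy, mul_add, Finset.sum_add_distrib]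
    | tmul f g =>
      rw [TensorProduct.map_tmul, LinearMap.mul'_apply, phiLin_apply, phi_singleton,
        Finset.sum_mul]
      refine Finset.sum_congr rfl fun l _ => ?_
      simp only [APL.contr, LinearMap.rTensor_tmul, LinearMap.comp_apply,
        LinearEquiv.coe_coe, TensorProduct.lid_tmul, map_smul, smul_mul_assoc, mul_smul_comm]
  rw [← List.singleton_append, phi_append, h]
  simp only [APL.contr_der_comulLin, phiLin_apply]

/-- A cocycle is determined by its values `φ^ρ_λ`. -/
lemma ext_phi {c c' : Cocycle R T N} (h : ∀ (ρ : Gens T N) (l : Lam), ρ.wt = l.wt →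
    c.phi (fLam l) [ρ] = c'.phi (fLam l) [ρ]) : c = c' := by
  have key : ∀ (w : List (Gens T N)) (f : APL), c.phi f w = c'.phi f w := by
    intro w
    induction w with
    | nil => intro f; rw [phi_nil, phi_nil]
    | cons ρ w ih =>
      intro f
      rw [phi_cons, phi_cons]
      exact Finset.sum_congr rfl fun l hl => by rw [ih, h ρ l (Lam.mem_ofWt.1 hl).symm]
  ext f
  exact ext_pairing fun w => key w f

end Cocycle

/-! ### Explicit coefficients on Λ: part (a). -/

section PolylogCocycles

lemma fLam_mem_homog (l : Lam) : fLam l ∈ APL.homog l.wt := mem_APL_homog.2 (isLen_fLam l)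

lemma LamFamily.mem_homog {lam : ℕ → Lam} {y : APL} (F : LamFamily lam y) : y ∈ APL.homog 1 := by
  rw [F.y_eq]
  exact add_mem (Submodule.smul_mem _ _ (fLam_mem_homog .e1))
    (Submodule.smul_mem _ _ (fLam_mem_homog .e2))

lemma Gens.exists_ofFn {T : Type*} {N : ℕ} (w : List (Gens T N)) (h : ∀ ρ ∈ w, ρ.wt = 1) :
    ∃ (r : ℕ) (τ : Fin r → T), w = List.ofFn fun i => .tau (τ i) := by
  have h' : ∀ ρ ∈ w, ∃ t, ρ = Gens.tau t := by
    intro ρ hρ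
    cases ρ with
    | tau t => exact ⟨t, rfl⟩
    | sigma m h1 h2 h3 =>
      have : m = 1 := h _ hρ
      omega
  choose f hf using fun i : Fin w.length => h' (w.get i) (List.get_mem w i)
  refine ⟨w.length, f, ?_⟩
  conv_lhs => rw [← List.ofFn_get w]
  exact congrArg List.ofFn (funext hf)

lemma wordWt_cons_tau {T : Type*} {N : ℕ} {r : ℕ} (σ : Gens T N) (τ : Fin r → T) :
    wordWt Gens.wt (σ :: List.ofFn fun i => .tau (τ i)) = σ.wt + r := by
  simp [wordWt, List.map_ofFn, Function.comp_def, Gens.wt, List.ofFn_const]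

namespace Cocycle

universe u v

variable {R : Type u} [CommRing R] [Algebra ℚ R] {T : Type v} {N : ℕ} (c : Cocycle R T N)
  {lam : ℕ → Lam} {y : APL}

/-- In the recursion only ∂_{e₁} and ∂_{e₂} act nontrivially on powers; each lowers the exponent by
one, and their coefficients `s1`, `s2` recombine to `y`. -/
lemma phi_pow_cons (F : LamFamily lam y) (ρ : Gens T N) (w : List (Gens T N)) (k : ℕ) :
    c.phi (F.pow (k + 1)) (ρ :: w) = c.phi y [ρ] * c.phi (F.pow k) w := by
  have h : ∀ l, c.phi (fLam l) [ρ] * c.phi (APL.der l (F.pow (k + 1))) w =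
      (if l = .e1 then (F.s1 • c.phi (fLam .e1) [ρ]) * c.phi (F.pow k) w else 0) +
      (if l = .e2 then (F.s2 • c.phi (fLam .e2) [ρ]) * c.phi (F.pow k) w else 0) := by
    intro l
    by_cases h1 : l = .e1
    · subst h1
      rw [if_pos rfl, if_neg (by simp), add_zero, F.der_e1_pow, ← phiLin_apply _ w, map_smul,
        phiLin_apply, mul_smul_comm, smul_mul_assoc]
    by_cases h2 : l = .e2
    · subst h2
      rw [if_pos rfl, if_neg (by simp), zero_add, F.der_e2_pow, ← phiLin_apply _ w, map_smul,
        phiLin_apply, mul_smul_comm, smul_mul_assoc]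
    · rw [if_neg h1, if_neg h2, F.der_pow l _ h1 h2, ← phiLin_apply _ w, map_zero, mul_zero,
        add_zero]
  rw [phi_cons, Finset.sum_congr rfl fun l _ => h l, Finset.sum_add_distrib, Finset.sum_ite_eq',
    Finset.sum_ite_eq']
  simp only [Lam.mem_ofWt, Lam.wt]
  have hy : c.phi y [ρ] = F.s1 • c.phi (fLam .e1) [ρ] + F.s2 • c.phi (fLam .e2) [ρ] := by
    conv_lhs => rw [F.y_eq]
    rw [← phiLin_apply, map_add, map_smul, map_smul, phiLin_apply, phiLin_apply]
  rw [hy]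
  -- If `ρ` does not have weight one, the sum contains neither e₁ nor e₂, and the factor at `y`
  -- vanishes by equivariance.
  by_cases hρ : ρ.wt = 1
  · rw [if_pos hρ.symm, if_pos hρ.symm, add_mul]
  · have h0 : ∀ l : Lam, l.wt = 1 → c.phi (fLam l) [ρ] = 0 := fun l hl =>
      c.phi_eq_zero (fLam_mem_homog l) (by rwa [wordWt_singleton, hl])
    rw [if_neg (fun h => hρ h.symm), if_neg (fun h => hρ h.symm), h0 .e1 rfl, h0 .e2 rfl]
    simp

lemma phi_pow (F : LamFamily lam y) (w : List (Gens T N)) (k : ℕ) : c.phi (F.pow k) w =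
    if w.length = k then (w.map fun ρ => c.phi y [ρ]).prod else 0 := by
  induction w generalizing k with
  | nil =>
    rw [phi_nil]
    cases k with
    | zero => simp [F.pow_zero, APL.eps_one]
    | succ k => simp [F.eps_pow_succ]
  | cons ρ w ih =>
    cases k with
    | zero => rw [F.pow_zero, phi_one_cons]; simp
    | succ k => rw [phi_pow_cons, ih]; simp

/-- Only members of the same family act nontrivially on f_λ, and the family has exactly one member
of the weight of `σ`, with index one less than that weight. So the recursion has at most one term.
-/
lemma phi_lam_cons (F : LamFamily lam y) (σ : Gens T N) (w : List (Gens T N)) (k : ℕ) :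
    c.phi (fLam (lam k)) (σ :: w) = if σ.wt ≤ k + 1 then
      c.phi (fLam (lam (σ.wt - 1))) [σ] * c.phi (F.pow (k + 1 - σ.wt)) w else 0 := by
  have hσ := one_le_wt σ
  rw [phi_cons, Finset.sum_eq_single (lam (σ.wt - 1))]
  · rw [F.der_lam]
    by_cases h : σ.wt ≤ k + 1
    · rw [if_pos h, if_pos (by omega), show k - (σ.wt - 1) = k + 1 - σ.wt by omega]
    · rw [if_neg h, if_neg (by omega), ← phiLin_apply _ w, map_zero, mul_zero]
  · intro l hl hne
    rw [F.der_lam_of_ne l k, ← phiLin_apply _ w, map_zero, mul_zero]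
    rintro j rfl
    rw [Lam.mem_ofWt, F.wt_lam] at hl
    exact hne (by rw [← hl, Nat.add_sub_cancel])
  · intro h
    exact absurd (Lam.mem_ofWt.2 (by rw [F.wt_lam]; omega)) h

/-- The values of a cocycle on the words `σ τ₁ ⋯ τ_r`. -/
lemma phi_lam_ofFn (F : LamFamily lam y) (n r : ℕ) (τ : Fin r → T) (σ : Gens T N)
    (hr : r ≤ n) (hσ : σ.wt = n - r) :
    c.phi (fLam (lam (n - 1))) (σ :: List.ofFn fun i => .tau (τ i)) =
      c.phi (fLam (lam (n - r - 1))) [σ] * ∏ i, c.phi y [.tau (τ i)] := by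
  -- Positivity of the weight forces r < n, so that none of the natural subtractions in the indices
  -- truncates.
  have h1 := one_le_wt σ
  rw [phi_lam_cons c F, if_pos (by omega), phi_pow, List.length_ofFn, if_pos (by omega), hσ,
    List.map_ofFn, List.prod_ofFn]
  rfl

/-- The coefficient is a product over the letters of `w` of values at `y`, which has degree one; a
letter of another weight gives a zero factor. -/
lemma wt_eq_one_of_phi_pow_ne_zero (F : LamFamily lam y) {w : List (Gens T N)} {k : ℕ}
    (h : c.phi (F.pow k) w ≠ 0) :
    ∀ ρ ∈ w, ρ.wt = 1 := by
  intro ρ hρ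
  by_contra hne
  apply h
  rw [phi_pow]
  split_ifs
  · refine List.prod_eq_zero (List.mem_map.2 ⟨ρ, hρ, ?_⟩)
    exact c.phi_eq_zero F.mem_homog (by rwa [wordWt_singleton])
  · rfl

lemma exists_of_phi_lam_ne_zero (F : LamFamily lam y) {w : List (Gens T N)} {k : ℕ}
    (h : c.phi (fLam (lam k)) w ≠ 0) :
    ∃ (r : ℕ) (τ : Fin r → T) (σ : Gens T N), w = σ :: List.ofFn fun i => .tau (τ i) := by
  cases w with
  | nil =>
    refine absurd (c.phi_eq_zero (fLam_mem_homog _) ?_) h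
    rw [F.wt_lam]
    simp [wordWt]
  | cons σ w =>
    rw [phi_lam_cons c F] at h
    split_ifs at h
    · obtain ⟨r, τ, rfl⟩ := Gens.exists_ofFn w
        (c.wt_eq_one_of_phi_pow_ne_zero F (right_ne_zero_of_mul h))
      exact ⟨r, τ, σ, rfl⟩
    · exact absurd rfl h

lemma exists_of_phi_pow_one_ne_zero (F : LamFamily lam y) {w : List (Gens T N)}
    (h : c.phi (F.pow 1) w ≠ 0) :
    ∃ (r : ℕ) (τ : Fin r → T) (σ : Gens T N), w = σ :: List.ofFn fun i => .tau (τ i) := by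
  rw [phi_pow] at h
  split_ifs at h with h1
  · obtain ⟨σ, rfl⟩ := List.length_eq_one_iff.1 h1
    exact ⟨0, Fin.elim0, σ, by simp⟩
  · exact absurd rfl h

/-- The shape of the word comes from the explicit formulas, with e₁ and e₂ treated as first powers;
the weight condition comes from equivariance. -/
lemma phi_fLam_eq_zero (l : Lam) (w : List (Gens T N))
    (hw : ¬ ∃ (r : ℕ) (τ : Fin r → T) (σ : Gens T N),
      w = σ :: List.ofFn (fun i => .tau (τ i)) ∧ σ.wt + r = l.wt) :
    c.phi (fLam l) w = 0 := by
  by_contra h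
  have key : ∃ (r : ℕ) (τ : Fin r → T) (σ : Gens T N),
      w = σ :: List.ofFn fun i => .tau (τ i) := by
    cases l with
    | e1 => exact c.exists_of_phi_pow_one_ne_zero family11 (by rwa [family11_pow_one])
    | e2 => exact c.exists_of_phi_pow_one_ne_zero family22 (by rwa [family22_pow_one])
    | l11 k => exact c.exists_of_phi_lam_ne_zero family11 h
    | l22 k => exact c.exists_of_phi_lam_ne_zero family22 h
    | l12 k => exact c.exists_of_phi_lam_ne_zero family12 h
  obtain ⟨r, τ, σ, rfl⟩ := key
  refine hw ⟨r, τ, σ, rfl, ?_⟩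
  by_contra hne
  exact h (c.phi_eq_zero (fLam_mem_homog l) (by rwa [wordWt_cons_tau]))

end Cocycle

end PolylogCocycles

/-! ### Construction of a cocycle with prescribed values. -/

section Existence

namespace Gens

variable {T : Type*} {N : ℕ}

instance [Finite T] : Finite (Gens T N) := by
  refine Finite.of_injective (β := T ⊕ Fin (N + 1))
    (fun ρ => match ρ with
      | tau t => Sum.inl t
      | sigma m _ _ h => Sum.inr ⟨m, Nat.lt_succ_of_le h⟩) ?_
  intro ρ ρ' h
  cases ρ <;> cases ρ' <;> simp_all

lemma length_le_wordWt (w : List (Gens T N)) : w.length ≤ wordWt Gens.wt w := by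
  induction w with
  | nil => simp
  | cons ρ w ih =>
    have := Cocycle.one_le_wt ρ
    simp only [wordWt, List.map_cons, List.sum_cons, List.length_cons] at ih ⊢
    omega

/-- All letters have weight at least one and the alphabet is finite. This makes the image of a word
under `sharpLin₀` a finite sum. -/
lemma finite_wordWt [Finite T] (n : ℕ) : {w : List (Gens T N) | wordWt Gens.wt w = n}.Finite :=
  (List.finite_length_le (Gens T N) n).subset fun w (hw : _ = n) => hw ▸ length_le_wordWt w

variable (T N) in
/-- The words of half-weight `n`. -/
def wordsOfWt [Finite T] (n : ℕ) : Finset (List (Gens T N)) := (finite_wordWt n).toFinset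

lemma mem_wordsOfWt [Finite T] {n : ℕ} {w : List (Gens T N)} :
    w ∈ wordsOfWt T N n ↔ wordWt Gens.wt w = n := by simp [wordsOfWt]

end Gens

namespace Cocycle

universe u v

variable {R : Type u} [CommRing R] [Algebra ℚ R] {T : Type v} {N : ℕ}
  (a : Gens T N → Lam → R)

/-- The derivation `∑_λ a^ρ_λ ∂_λ` of `R ⊗ A(Γ)`. -/
def step (ρ : Gens T N) : R ⊗[ℚ] Sh PLGen →ₗ[R] R ⊗[ℚ] Sh PLGen :=
  ∑ l ∈ Lam.ofWt ρ.wt, a ρ l • (l.der : Sh PLGen →ₗ[ℚ] Sh PLGen).baseChange R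

lemma step_apply (ρ : Gens T N) (x : R ⊗[ℚ] Sh PLGen) : step a ρ x =
    ∑ l ∈ Lam.ofWt ρ.wt, a ρ l • (l.der : Sh PLGen →ₗ[ℚ] Sh PLGen).baseChange R x := by
  simp [step, LinearMap.sum_apply]

lemma step_one_tmul (ρ : Gens T N) (f : Sh PLGen) : step a ρ (1 ⊗ₜ f) =
    ∑ l ∈ Lam.ofWt ρ.wt, a ρ l • ((1 : R) ⊗ₜ[ℚ] l.der f) := by
  rw [step_apply]; rfl

lemma step_mul (ρ : Gens T N) (x y : R ⊗[ℚ] Sh PLGen) :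
    step a ρ (x * y) = step a ρ x * y + x * step a ρ y := by
  simp only [step_apply, baseChange_derivation_mul, smul_add, Finset.sum_add_distrib,
    Finset.sum_mul, Finset.mul_sum, smul_mul_assoc, mul_smul_comm]

lemma step_one (ρ : Gens T N) : step a ρ 1 = 0 := by
  rw [Algebra.TensorProduct.one_def, step_one_tmul]
  exact Finset.sum_eq_zero fun l _ => by
    rw [Derivation.map_one_eq_zero, TensorProduct.tmul_zero, smul_zero]

/-- The coefficients of the homomorphism of coordinate rings with prescribed values on the
generators. -/
def psi : List (Gens T N) → (R ⊗[ℚ] Sh PLGen →ₗ[R] R)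
  | [] => pairing []
  | ρ :: w => psi w ∘ₗ step a ρ

lemma psi_nil : psi a [] = pairing [] := rfl

lemma psi_cons (ρ : Gens T N) (w : List (Gens T N)) (x : R ⊗[ℚ] Sh PLGen) :
    psi a (ρ :: w) x = psi a w (step a ρ x) := rfl

/-- Every ∂_λ in `step a ρ` lowers the length by the weight of `ρ`, so the constant term left at the
end is nonzero only if the weights add up to n. -/
lemma psi_eq_zero (w : List (Gens T N)) {n : ℤ} {f : Sh PLGen} (hf : Sh.IsLen n f)
    (hw : (wordWt Gens.wt w : ℤ) ≠ n) : psi a w (1 ⊗ₜ f) = 0 := by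
  induction w generalizing n f with
  | nil => rw [psi_nil, pairing_tmul, hf [] (by simpa [wordWt] using hw), zero_smul]
  | cons ρ w ih =>
    rw [psi_cons, step_one_tmul, map_sum]
    refine Finset.sum_eq_zero fun l hl => ?_
    rw [map_smul, ih (l.der_isLen hf), smul_zero]
    rw [Lam.mem_ofWt.1 hl]
    simp only [wordWt, List.map_cons, List.sum_cons] at hw ⊢
    push_cast at hw ⊢
    omega

/-- The letters of `u` act first, and each ∂_λ passes through the coproduct to the left factor. Once
`u` is used up, the counit removes that factor. -/
lemma psi_append (u v : List (Gens T N)) (f : Sh PLGen) : psi a (u ++ v) (1 ⊗ₜ f) =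
    LinearMap.mul' R R (TensorProduct.map (psi a u) (psi a v)
      (baseChange₂ R (Sh PLGen) (Sh.comulLin f))) := by
  induction u generalizing f with
  | nil =>
    have h : ∀ t : Sh PLGen ⊗[ℚ] Sh PLGen, LinearMap.mul' R R
        (TensorProduct.map (psi a []) (psi a v) (baseChange₂ R (Sh PLGen) t)) =
        psi a v (1 ⊗ₜ Sh.contrL [] t) := by
      intro t
      induction t with
      | zero => simp
      | add x y hx hy => simp only [map_add, TensorProduct.tmul_add, hx, hy]
      | tmul f g =>
        rw [baseChange₂_tmul, TensorProduct.map_tmul, LinearMap.mul'_apply, psi_nil, pairing_tmul,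
          Sh.contrL_tmul, TensorProduct.tmul_smul, ← algebraMap_smul R (Sh.coeff [] f) (1 ⊗ₜ g),
          map_smul, Algebra.algebraMap_eq_smul_one, smul_eq_mul]
    rw [h, Sh.contrL_nil_comulLin, List.nil_append]
  | cons ρ u ih =>
    have h : ∀ t : Sh PLGen ⊗[ℚ] Sh PLGen, LinearMap.mul' R R
        (TensorProduct.map (psi a (ρ :: u)) (psi a v) (baseChange₂ R (Sh PLGen) t)) =
        ∑ l ∈ Lam.ofWt ρ.wt, a ρ l • LinearMap.mul' R R (TensorProduct.map (psi a u) (psi a v)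
          (baseChange₂ R (Sh PLGen)
            ((l.der : Sh PLGen →ₗ[ℚ] Sh PLGen).rTensor (Sh PLGen) t))) := by
      intro t
      induction t with
      | zero => simp
      | add x y hx hy => simp only [map_add, hx, hy, smul_add, Finset.sum_add_distrib]
      | tmul f g =>
        rw [baseChange₂_tmul, TensorProduct.map_tmul, LinearMap.mul'_apply, psi_cons,
          step_one_tmul, map_sum, Finset.sum_mul]
        refine Finset.sum_congr rfl fun l _ => ?_
        rw [map_smul, smul_mul_assoc]
        rfl
    rw [List.cons_append, psi_cons, step_one_tmul, map_sum, h]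
    refine Finset.sum_congr rfl fun l _ => ?_
    rw [map_smul, ih, Lam.rTensor_der_comulLin]

variable [Finite T]

/-- The linear map with coefficients `psi`. -/
def sharpLin₀ : Sh PLGen →ₗ[ℚ] R ⊗[ℚ] Sh (Gens T N) :=
  Sh.basis.constr ℚ fun u =>
    ∑ w ∈ Gens.wordsOfWt T N u.length, psi a w (1 ⊗ₜ Sh.word u) ⊗ₜ Sh.word w

lemma sharpLin₀_word (u : List PLGen) : sharpLin₀ a (Sh.word u) =
    ∑ w ∈ Gens.wordsOfWt T N u.length, psi a w (1 ⊗ₜ Sh.word u) ⊗ₜ Sh.word w := by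
  rw [sharpLin₀, ← Sh.basis_apply, Module.Basis.constr_basis, Sh.basis_apply]

/-- The extension of scalars of `sharpLin₀`. -/
def sharpLin : R ⊗[ℚ] Sh PLGen →ₗ[R] R ⊗[ℚ] Sh (Gens T N) := (sharpLin₀ a).liftBaseChange R

lemma sharpLin_one_tmul (f : Sh PLGen) : sharpLin a (1 ⊗ₜ f) = sharpLin₀ a f := by
  simp [sharpLin]

lemma pairing_sharpLin (w : List (Gens T N)) (x : R ⊗[ℚ] Sh PLGen) :
    pairing w (sharpLin a x) = psi a w x := by
  classical
  have h : (pairing w).restrictScalars ℚ ∘ₗ sharpLin₀ a =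
      (psi a w).restrictScalars ℚ ∘ₗ TensorProduct.mk ℚ R (Sh PLGen) 1 := by
    refine Sh.hom_ext fun u => ?_
    simp only [LinearMap.comp_apply, LinearMap.restrictScalars_apply, TensorProduct.mk_apply,
      sharpLin₀_word, map_sum, pairing_tmul, Sh.coeff_word, ite_smul, one_smul, zero_smul,
      Finset.sum_ite_eq', Gens.mem_wordsOfWt]
    split_ifs with hw
    · rfl
    · exact (psi_eq_zero a w (Sh.isLen_word u) (by exact_mod_cast hw)).symm
  induction x with
  | zero => simp
  | add x y hx hy => simp only [map_add, hx, hy]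
  | tmul r f =>
    have h1 : r ⊗ₜ[ℚ] f = r • ((1 : R) ⊗ₜ[ℚ] f) := by
      rw [TensorProduct.smul_tmul', smul_eq_mul, mul_one]
    rw [h1, map_smul, map_smul, map_smul, sharpLin_one_tmul]
    exact congrArg (r • ·) (LinearMap.congr_fun h f)

/-- `sharpLin` intertwines deletion of `ρ` with the derivation `step a ρ`. Both are derivations, so
multiplicativity follows by induction on the word. -/
lemma delR_sharpLin (ρ : Gens T N) (x : R ⊗[ℚ] Sh PLGen) :
    (Sh.del ρ).baseChange R (sharpLin a x) = sharpLin a (step a ρ x) :=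
  ext_pairing fun w => by
    rw [pairing_delR, pairing_sharpLin, pairing_sharpLin, psi_cons]

lemma sharpLin_one : sharpLin a 1 = 1 := by
  refine ext_pairing fun w => ?_
  rw [pairing_sharpLin]
  cases w with
  | nil =>
    rw [psi_nil, Algebra.TensorProduct.one_def, Algebra.TensorProduct.one_def, pairing_tmul,
      pairing_tmul, Sh.coeff_nil_one, Sh.coeff_nil_one]
  | cons ρ w =>
    rw [psi_cons, step_one, map_zero, Algebra.TensorProduct.one_def, pairing_tmul,
      ← Sh.coeff_del, Sh.del_one, map_zero, zero_smul]

lemma sharpLin_mul (x y : R ⊗[ℚ] Sh PLGen) :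
    sharpLin a (x * y) = sharpLin a x * sharpLin a y := by
  refine ext_pairing fun w => ?_
  induction w generalizing x y with
  | nil =>
    rw [pairing_nil_mul, pairing_sharpLin, pairing_sharpLin, pairing_sharpLin, psi_nil,
      pairing_nil_mul]
  | cons ρ w ih =>
    rw [pairing_cons_mul, delR_sharpLin, delR_sharpLin, ← ih, ← ih, pairing_sharpLin, psi_cons,
      step_mul, map_add, pairing_sharpLin, pairing_sharpLin]

lemma comul_sharpLin (f : Sh PLGen) : Coalgebra.comul (R := R) (sharpLin a (1 ⊗ₜ f)) =
    TensorProduct.map (sharpLin a) (sharpLin a) (baseChange₂ R (Sh PLGen) (Sh.comulLin f)) := by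
  refine ext_pairing₂ fun u v => ?_
  rw [pairing₂_comul, pairing_sharpLin, psi_append]
  generalize baseChange₂ R (Sh PLGen) (Sh.comulLin f) = t
  induction t with
  | zero => simp
  | add x y hx hy => simp only [map_add, hx, hy]
  | tmul x y =>
    rw [TensorProduct.map_tmul, TensorProduct.map_tmul, pairing₂_tmul, pairing_sharpLin,
      pairing_sharpLin, LinearMap.mul'_apply]

/-- The homomorphism of coordinate rings with coefficients `psi`, restricted to `A^PL`. -/
def sharpHom : R ⊗[ℚ] APL →ₐ[R] R ⊗[ℚ] Sh (Gens T N) :=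
  (AlgHom.ofLinearMap (sharpLin a) (sharpLin_one a) (sharpLin_mul a)).comp
    (Algebra.TensorProduct.map (AlgHom.id R R) APL.val)

lemma sharpHom_one_tmul (f : APL) :
    sharpHom a (1 ⊗ₜ f) = sharpLin a (1 ⊗ₜ (f : Sh PLGen)) := by
  simp [sharpHom]

lemma comul_sharpHom (x : R ⊗[ℚ] APL) : Coalgebra.comul (R := R) (sharpHom a x) =
    TensorProduct.map (sharpHom a).toLinearMap (sharpHom a).toLinearMap
      (Coalgebra.comul (R := R) x) := by
  induction x with
  | zero => simp
  | add x y hx hy => simp only [map_add, hx, hy]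
  | tmul r f =>
    have h1 : r ⊗ₜ[ℚ] f = r • ((1 : R) ⊗ₜ[ℚ] f) := by
      rw [TensorProduct.smul_tmul', smul_eq_mul, mul_one]
    have h2 : ∀ z : APL, (sharpHom a).toLinearMap (1 ⊗ₜ z) = sharpLin a (1 ⊗ₜ (z : Sh PLGen)) :=
      sharpHom_one_tmul a
    have h3 : ∀ t : APL ⊗[ℚ] APL,
        TensorProduct.map (sharpLin a) (sharpLin a) (baseChange₂ R (Sh PLGen)
          (TensorProduct.map (coordRing.incl plGen) (coordRing.incl plGen) t)) =
        TensorProduct.map (sharpHom a).toLinearMap (sharpHom a).toLinearMap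
          (baseChange₂ R APL t) := by
      intro t
      induction t with
      | zero => simp
      | add x y hx hy => simp only [map_add, hx, hy]
      | tmul x y =>
        rw [TensorProduct.map_tmul, baseChange₂_tmul, baseChange₂_tmul, TensorProduct.map_tmul,
          TensorProduct.map_tmul, h2, h2]
        rfl
    rw [h1, map_smul, map_smul, map_smul, map_smul, sharpHom_one_tmul, comul_sharpLin,
      ← coordRing.map_incl_comulLin, h3, comul_tmul_eq, one_smul]
    rfl

lemma sharpHom_pointMul {S : Type*} [CommRing S] [Algebra R S]
    (γ γ' : R ⊗[ℚ] Sh (Gens T N) →ₐ[R] S) :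
    (pointMul γ γ').comp (sharpHom a) =
      pointMul (γ.comp (sharpHom a)) (γ'.comp (sharpHom a)) := by
  let L := LinearMap.mul' R S ∘ₗ TensorProduct.map γ.toLinearMap γ'.toLinearMap
  refine AlgHom.ext fun x => ?_
  rw [AlgHom.comp_apply, pointMul_apply γ γ' L (map_zero L) (map_add L) (fun _ _ => rfl),
    comul_sharpHom]
  exact (pointMul_apply _ _ (L ∘ₗ TensorProduct.map (sharpHom a).toLinearMap
    (sharpHom a).toLinearMap) (map_zero _) (map_add _) (fun _ _ => rfl) x).symm

lemma sharpLin₀_mem {n : ℕ} {f : Sh PLGen} (hf : f ∈ Sh.homog (fun _ : PLGen => 1) n) :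
    sharpLin₀ a f ∈ (Sh.homog (Gens.wt (T := T) (N := N)) n).baseChange R := by
  rw [Sh.homog] at hf
  induction hf using Submodule.span_induction with
  | mem f hf =>
    obtain ⟨u, hu, rfl⟩ := hf
    rw [sharpLin₀_word]
    refine sum_mem fun w hw => Submodule.tmul_mem_baseChange_of_mem _
      (Submodule.subset_span ⟨w, ?_, rfl⟩)
    rw [Gens.mem_wordsOfWt.1 hw, ← hu, Sh.wordWt_one]
  | zero => rw [map_zero]; exact zero_mem _
  | add f g _ _ hf hg => rw [map_add]; exact add_mem hf hg
  | smul t f _ hf =>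
    rw [map_smul, ← algebraMap_smul R t]
    exact Submodule.smul_mem _ _ hf

/-- The cocycle with prescribed values `φ^ρ_λ`. -/
def ofValues : Cocycle R T N where
  sharp := sharpHom a
  map_pointMul _ _ _ := sharpHom_pointMul a
  equivariant n f hf := by
    rw [sharpHom_one_tmul, sharpLin_one_tmul]
    exact sharpLin₀_mem a hf

/-- A one-letter word applies `step a ρ` once, and duality of the ∂_μ with f_λ leaves only the term
μ = λ, which is present because the weights agree. -/
lemma phi_ofValues (ρ : Gens T N) (l : Lam) (h : ρ.wt = l.wt) :
    (ofValues a).phi (fLam l) [ρ] = a ρ l := by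
  have h1 : (ofValues a).phi (fLam l) [ρ] = psi a [ρ] (1 ⊗ₜ (fLam l : Sh PLGen)) := by
    rw [← pairing_sharpLin, ← sharpHom_one_tmul]; rfl
  have h2 : ∀ μ : Lam, Sh.coeff [] (μ.der (fLam l)) = if μ = l then 1 else 0 :=
    fun μ => eps_der_fLam μ l
  rw [h1, psi_cons, step_one_tmul, psi_nil, map_sum]
  simp only [map_smul, pairing_tmul, h2, ite_smul, one_smul, zero_smul, smul_eq_mul, mul_ite,
    mul_one, mul_zero, Finset.sum_ite_eq', Lam.mem_ofWt]
  rw [if_pos h.symm]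

end Cocycle

end Existence

end

theorem proposition4p4 {R : Type*} [CommRing R] [Algebra ℚ R] (T : Type*) [Finite T] (N : ℕ) :
    (∀ c : Cocycle R T N,
      (∀ (n r : ℕ) (τ : Fin r → T) (σ : Gens T N), r ≤ n → σ.wt = n - r →
        c.phi (fLam (.l11 (n - 1))) (σ :: List.ofFn fun i => .tau (τ i)) =
          c.phi (fLam (.l11 (n - r - 1))) [σ] * ∏ i, c.phi (fLam .e1) [.tau (τ i)] ∧
        c.phi (fLam (.l22 (n - 1))) (σ :: List.ofFn fun i => .tau (τ i)) =
          c.phi (fLam (.l22 (n - r - 1))) [σ] * ∏ i, c.phi (fLam .e2) [.tau (τ i)] ∧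
        c.phi (fLam (.l12 (n - 1))) (σ :: List.ofFn fun i => .tau (τ i)) =
          c.phi (fLam (.l12 (n - r - 1))) [σ] *
            ∏ i, c.phi (fLam .e1 + fLam .e2) [.tau (τ i)]) ∧
      (∀ (l : Lam) (w : List (Gens T N)),
        (¬ ∃ (r : ℕ) (τ : Fin r → T) (σ : Gens T N),
          w = σ :: List.ofFn (fun i => .tau (τ i)) ∧ σ.wt + r = l.wt) →
        c.phi (fLam l) w = 0)) ∧
    (∀ a : (ρ : Gens T N) → (l : Lam) → ρ.wt = l.wt → R,
      ∃! c : Cocycle R T N,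
        ∀ (ρ : Gens T N) (l : Lam) (h : ρ.wt = l.wt), c.phi (fLam l) [ρ] = a ρ l h) := by
  refine ⟨fun c => ⟨fun n r τ σ hr hσ => ⟨c.phi_lam_ofFn family11 n r τ σ hr hσ,
    c.phi_lam_ofFn family22 n r τ σ hr hσ, c.phi_lam_ofFn family12 n r τ σ hr hσ⟩,
    c.phi_fLam_eq_zero⟩, fun a => ?_⟩
  classical
  -- The extension by zero to unequal weights is harmless: only λ of the weight of `ρ` enter
  -- `Cocycle.step`.
  refine ⟨Cocycle.ofValues fun ρ l => if h : ρ.wt = l.wt then a ρ l h else 0,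
    fun ρ l h => (Cocycle.phi_ofValues _ ρ l h).trans (dif_pos h), fun c hc => ?_⟩
  exact Cocycle.ext_phi fun ρ l h =>
    (hc ρ l h).trans ((Cocycle.phi_ofValues _ ρ l h).trans (dif_pos h)).symm
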